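/- Work in the real projective plane $\mathbb{RP}^2\supset\mathbb R^2$. For $V\in\mathbb R^2$, two pairs of lines through $V$ are *isogonal* if they have the same pair of angle bisectors; for a point $V$ at infinity, pairs $(\ell_1,\ell_2),(m_1,m_2)$ of affine lines through $V$ are isogonal if, for every line not through $V$ meeting $\ell_1,m_1,\ell_2,m_2$ at $E,F,G,H\in\mathbb R^2$, the directed lengths $EF$ and $HG$ are equal. A *quadrilateral* $ABCD$ consists of four distinct points $A,B,C,D\in\mathbb R^2$ in order. A cubic $\mathcal C\subset\mathbb{RP}^2$ is the *isogonal cubic* of $ABCD$ if it is the set consisting of $A,B,C,D$ and of all points $X$ for which $(XA,XC)$ and $(XB,XD)$ are isogonal; it is non-degenerate if its equation is irreducible. In that case two points $X,X'$ are *isogonal conjugates* in $ABCD$ if $(AX,AX'),(AB,AD)$ are isogonal and the analogous condition holds at $B$, $C$ and $D$. Here and below, for points $X,Y$, the line $XY$ means the tangent to $\mathcal C$ at $X$ if $X=Y$. The *spiral center* of $ABCD$ is the center of the spiral similarity with $A\mapsto D$, $B\mapsto C$. For $X,Y\in\mathcal C$, $XY\cap\mathcal C$ denotes the third intersection of the line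 $XY$ with $\mathcal C$, counted with multiplicity; if $X$ or $Y$ is a singular point of $\mathcal C$, it denotes that singular point. **Theorem (Uniqueness of the Isogonal Conjugate).** Let $\mathcal C\subset\mathbb{RP}^2$ be a non-degenerate cubic that is the isogonal cubic of at least one quadrilateral. Then $\mathcal C$ has exactly one point $P_\infty$ at infinity, and all quadrilaterals whose isogonal cubic is $\mathcal C$ have one and the same spiral center $P$, which lies on $\mathcal C$. For every $X\in\mathcal C$ there is exactly one point $X'$ that is the isogonal conjugate of $X$ in any quadrilateral with isogonal cubic $\mathcal C$: for every such quadrilateral $ABCD$ and every point $Z\in\mathbb{RP}^2$, the points $X$ and $Z$ are isogonal conjugates in $ABCD$ if and only if $Z=X'$. This point lies on $\mathcal C$ and is given by $X'=P_\infty Y\cap\mathcal C$, where $Y=PX\cap\mathcal C$. -/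

import Mathlib

open scoped LinearAlgebra.Projectivization

noncomputable section

/-! The Euclidean plane is `ℂ` with its real inner product; the real projective plane is
`ℙ ℝ (Fin 3 → ℝ)`, with line at infinity `z = 0`; a projective line is a two-dimensional
subspace of `ℝ³`. -/

/-- The real projective plane. -/
abbrev RP2 : Type := ℙ ℝ (Fin 3 → ℝ)

/-- The projective point `(x : y : 1)` of the point `x + iy` of the Euclidean plane. -/
def affinePt (z : ℂ) : RP2 :=
  Projectivization.mk ℝ ![z.re, z.im, 1] (fun h => by simpa using congrFun h 2)

def AtInfinity (X : RP2) : Prop := X.rep 2 = 0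

/-- A projective line, or any other subspace of `ℝ³` in the role of one. -/
abbrev ProjLine : Type := Submodule ℝ (Fin 3 → ℝ)

/-- Incidence of a point and a line. -/
def OnLine (X : RP2) (l : ProjLine) : Prop := X.submodule ≤ l

/-- The line joining two distinct points. -/
def joinLine (X Y : RP2) : ProjLine := X.submodule ⊔ Y.submodule

/-- The vector `w` of the Euclidean plane as the vector `(w.re, w.im, 0)` of `ℝ³`. -/
def infinityMap : ℂ →ₗ[ℝ] (Fin 3 → ℝ) where
  toFun w := ![w.re, w.im, 0]
  map_add' v w := by ext i; fin_cases i <;> simp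
  map_smul' r w := by ext i; fin_cases i <;> simp

/-- The direction of an affine line, as a one-dimensional space of vectors of the plane. -/
def lineDirection (l : ProjLine) : Submodule ℝ ℂ := l.comap infinityMap

/-! ### Cubic curves -/

/-- A non-degenerate (that is, irreducible) real cubic form. A real cubic form that is
irreducible over `ℝ` is irreducible over `ℂ` too. -/
def IsNondegenerateCubic (F : MvPolynomial (Fin 3) ℝ) : Prop :=
  F.IsHomogeneous 3 ∧ Irreducible F

/-- The zero locus of a form in the real projective plane. -/
def curve (F : MvPolynomial (Fin 3) ℝ) : Set RP2 :=
  {X | MvPolynomial.eval X.rep F = 0}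

/-- A point at which all the partial derivatives vanish. -/
def IsSingularPt (F : MvPolynomial (Fin 3) ℝ) (X : RP2) : Prop :=
  ∀ i, MvPolynomial.eval X.rep (MvPolynomial.pderiv i F) = 0

/-- The tangent line of the curve `F = 0` at a (nonsingular) point `X`. -/
def tangentAt (F : MvPolynomial (Fin 3) ℝ) (X : RP2) : ProjLine where
  carrier := {v | ∑ i, MvPolynomial.eval X.rep (MvPolynomial.pderiv i F) * v i = 0}
  add_mem' {v w} hv hw := by
    simp only [Set.mem_ofPred_eq, Pi.add_apply, mul_add, Finset.sum_add_distrib] at *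
    rw [hv, hw, add_zero]
  zero_mem' := by simp
  smul_mem' r v hv := by
    simp only [Set.mem_ofPred_eq, Pi.smul_apply, smul_eq_mul] at *
    simp only [mul_left_comm _ r, ← Finset.mul_sum, hv, mul_zero]

open Classical in
/-- The line `XY`: the join of `X` and `Y` if they are distinct, and the tangent of the curve
at `X` if `X = Y`. -/
def lineXY (F : MvPolynomial (Fin 3) ℝ) (X Y : RP2) : ProjLine :=
  if X = Y then tangentAt F X else joinLine X Y

/-- The polynomial `t ↦ F (x + t v)`. -/
def restrictToLine (F : MvPolynomial (Fin 3) ℝ) (x v : Fin 3 → ℝ) : Polynomial ℝ :=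
  MvPolynomial.aeval
    (fun i => Polynomial.C (x i) + Polynomial.X * Polynomial.C (v i)) F

/-- `X` is an inflection point: a nonsingular point of the curve at which the tangent meets the
curve with multiplicity at least three. -/
def IsInflectionPt (F : MvPolynomial (Fin 3) ℝ) (X : RP2) : Prop :=
  X ∈ curve F ∧ ¬ IsSingularPt F X ∧
    ∀ v ∈ tangentAt F X, (Polynomial.X : Polynomial ℝ) ^ 3 ∣ restrictToLine F X.rep v

/-- The line `l` is the tangent of the curve at its nonsingular point `T`. -/
def IsTangencyPt (F : MvPolynomial (Fin 3) ℝ) (l : ProjLine) (T : RP2) : Prop :=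
  T ∈ curve F ∧ ¬ IsSingularPt F T ∧ tangentAt F T = l

/-- `Z = XY ∩ 𝒞`, for points `X`, `Y` of the curve `𝒞 : F = 0`:
* if `X` or `Y` is singular, `Z` is the singular one;
* if `X ≠ Y` and `XY` is not tangent to the curve, `Z` is the third intersection;
* if `X ≠ Y` and `XY` is tangent to the curve, `Z` is the tangency point;
* if `X = Y` is not an inflection point, `Z` is the other intersection of the tangent at `X`;
* if `X = Y` is an inflection point, `Z = X`. -/
def IsThirdIntersection (F : MvPolynomial (Fin 3) ℝ) (X Y Z : RP2) : Prop :=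
  (IsSingularPt F X ∧ Z = X) ∨
  (IsSingularPt F Y ∧ Z = Y) ∨
  (¬ IsSingularPt F X ∧ ¬ IsSingularPt F Y ∧
    ((X ≠ Y ∧ (¬ ∃ T, IsTangencyPt F (joinLine X Y) T) ∧
        Z ∈ curve F ∧ OnLine Z (joinLine X Y) ∧ Z ≠ X ∧ Z ≠ Y) ∨
      (X ≠ Y ∧ IsTangencyPt F (joinLine X Y) Z) ∨
      (X = Y ∧ ¬ IsInflectionPt F X ∧
        Z ∈ curve F ∧ OnLine Z (tangentAt F X) ∧ Z ≠ X) ∨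
      (X = Y ∧ IsInflectionPt F X ∧ Z = X)))

/-! ### Isogonality -/

/-- `b` is the direction of one of the two bisectors of two lines with directions `l`, `m`: the
reflection in `b` carries `l` to `m`. -/
def IsBisector (l m b : Submodule ℝ ℂ) : Prop :=
  Module.finrank ℝ b = 1 ∧ ∀ w : ℂ, w ∈ l ↔ b.reflection w ∈ m

/-- The pairs of lines `(l₁, l₂)`, `(m₁, m₂)` through the affine point `P` share the same pair of
angle bisectors (all of these pass through `P`, so that directions suffice). -/
def ShareBisectors (l₁ l₂ m₁ m₂ : ProjLine) : Prop :=
  ∀ b : Submodule ℝ ℂ,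
    IsBisector (lineDirection l₁) (lineDirection l₂) b ↔
      IsBisector (lineDirection m₁) (lineDirection m₂) b

/-- The version for lines through a point `P` at infinity: whenever a line `k` (not through `P`)
meets `l₁, m₁, l₂, m₂` at the affine points `E, F, G, H`, the directed lengths `EF` and `HG` are
equal. -/
def IsogonalAtInfinity (P : RP2) (l₁ l₂ m₁ m₂ : ProjLine) : Prop :=
  ∀ k : ProjLine, Module.finrank ℝ k = 2 → ¬ OnLine P k →
    ∀ E F G H : ℂ,
      OnLine (affinePt E) k → OnLine (affinePt F) k →
      OnLine (affinePt G) k → OnLine (affinePt H) k →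
      OnLine (affinePt E) l₁ → OnLine (affinePt F) m₁ →
      OnLine (affinePt G) l₂ → OnLine (affinePt H) m₂ → F - E = G - H

/-- The pairs of lines `(l₁, l₂)`, `(m₁, m₂)` through `P` are isogonal. -/
def Isogonal (P : RP2) (l₁ l₂ m₁ m₂ : ProjLine) : Prop :=
  (¬ AtInfinity P → ShareBisectors l₁ l₂ m₁ m₂) ∧
  (AtInfinity P → IsogonalAtInfinity P l₁ l₂ m₁ m₂)

/-- Four distinct points of the plane, in order. -/
structure Quadrilateral where
  A : ℂ
  B : ℂ
  C : ℂ
  D : ℂ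
  ne_AB : A ≠ B
  ne_AC : A ≠ C
  ne_AD : A ≠ D
  ne_BC : B ≠ C
  ne_BD : B ≠ D
  ne_CD : C ≠ D

namespace Quadrilateral

def IsVertex (Q : Quadrilateral) (X : RP2) : Prop :=
  X = affinePt Q.A ∨ X = affinePt Q.B ∨ X = affinePt Q.C ∨ X = affinePt Q.D

/-- `X` is excellent: `(XA, XC)` and `(XB, XD)` are isogonal. At a vertex one of these lines is
not determined by the points alone; the vertices belong to the locus. -/
def Excellent (Q : Quadrilateral) (X : RP2) : Prop :=
  Q.IsVertex X ∨
    Isogonal X (joinLine X (affinePt Q.A)) (joinLine X (affinePt Q.C))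
      (joinLine X (affinePt Q.B)) (joinLine X (affinePt Q.D))

/-- The curve `F = 0` is the isogonal cubic of `Q`: it is the locus of the excellent points. -/
def HasIsogonalCubic (Q : Quadrilateral) (F : MvPolynomial (Fin 3) ℝ) : Prop :=
  ∀ X : RP2, X ∈ curve F ↔ Q.Excellent X

/-- `X` and `Z` are isogonal conjugates in `Q`: at every vertex the lines to `X` and `Z` are
isogonal with respect to the two sides. If `X` or `Z` is itself the vertex, the line to it is the
tangent of the isogonal cubic `F = 0` at that vertex. -/
def IsogonalConjugates (Q : Quadrilateral) (F : MvPolynomial (Fin 3) ℝ) (X Z : RP2) : Prop :=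
  Isogonal (affinePt Q.A) (lineXY F (affinePt Q.A) X) (lineXY F (affinePt Q.A) Z)
    (joinLine (affinePt Q.A) (affinePt Q.B)) (joinLine (affinePt Q.A) (affinePt Q.D)) ∧
  Isogonal (affinePt Q.B) (lineXY F (affinePt Q.B) X) (lineXY F (affinePt Q.B) Z)
    (joinLine (affinePt Q.B) (affinePt Q.A)) (joinLine (affinePt Q.B) (affinePt Q.C)) ∧
  Isogonal (affinePt Q.C) (lineXY F (affinePt Q.C) X) (lineXY F (affinePt Q.C) Z)
    (joinLine (affinePt Q.C) (affinePt Q.B)) (joinLine (affinePt Q.C) (affinePt Q.D)) ∧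
  Isogonal (affinePt Q.D) (lineXY F (affinePt Q.D) X) (lineXY F (affinePt Q.D) Z)
    (joinLine (affinePt Q.D) (affinePt Q.C)) (joinLine (affinePt Q.D) (affinePt Q.A))

/-- `P` is the spiral center of `ABCD`: the fixed point of the spiral similarity
`z ↦ P + k (z - P)` that carries `A` to `D` and `B` to `C`. -/
def IsSpiralCenter (Q : Quadrilateral) (P : ℂ) : Prop :=
  ∃ k : ℂ, k ≠ 0 ∧ Q.D - P = k * (Q.A - P) ∧ Q.C - P = k * (Q.B - P)

end Quadrilateral

end

/-! Read the plane as ℂ, put δ = A + C - B - D and P = (AC - BD)/δ, and use the coordinate η = (z -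
P)/δ. The vertices get coordinates α, β, γ, ε with αγ = βε = q and α + γ = β + ε + 1, and P is the
spiral center. Then (α - η)(γ - η) - (β - η)(ε - η) = -η, so at an excellent point η ≠ 0 the number
η + q/η - (β + ε) is real, and the locus is Im(η + q/η) = k with k = Im(α + γ). Clearing
denominators gives the cubic form `frameForm`. The zeros of F lie among its zeros, and since F is
irreducible with enough real zeros, F is a constant multiple of it (`dvd_of_zeros_subset`,
`nonempty_isogonalFrame`).

Isogonal conjugation is the involution η ↦ q/η, which preserves the equation and exchanges P with
the point at infinity. At a vertex v the directions of the two sides have product ±v, and (η -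
v)(q/η - v)/v = (v + q/v) - (η + q/η) is real on the curve; the tangent at v covers the limiting
case (`IsRegular.isogonalAt_of_conj`). For uniqueness, X determines the isogonal line at each
vertex, so two distinct conjugates would put all four vertices on one line, which non-degeneracy
excludes (`not_collinear`).

For the construction, the line from P to η meets the curve again in a point Y of the line of height
Im(q/η). That line passes through the point at infinity and meets the curve in q/η
(`exists_thirdIntersections`). Tangencies need no separate geometry: F restricted to a line is split
into three linear factors (`isThirdIntersection_iff_of_factor`). Finally P does not depend on the
quadrilateral (`center_eq`), so neither does the point constructed from it. -/

noncomputable section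

/-! ### Cubic forms along a line -/

section CubicForm

open MvPolynomial

/-- The differential of `F` at `x`, applied to `y`. -/
def polarForm (F : MvPolynomial (Fin 3) ℝ) (x y : Fin 3 → ℝ) : ℝ :=
  ∑ i, eval x (pderiv i F) * y i

lemma polarForm_mul (F G : MvPolynomial (Fin 3) ℝ) (x y : Fin 3 → ℝ) :
    polarForm (F * G) x y = eval x F * polarForm G x y + eval x G * polarForm F x y := by
  simp only [polarForm, Derivation.leibniz, map_add, smul_eq_mul, map_mul, Fin.sum_univ_three]
  ring

lemma polarForm_add (F G : MvPolynomial (Fin 3) ℝ) (x y : Fin 3 → ℝ) :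
    polarForm (F + G) x y = polarForm F x y + polarForm G x y := by
  simp only [polarForm, map_add, Fin.sum_univ_three]
  ring

lemma polarForm_smul_right (F : MvPolynomial (Fin 3) ℝ) (x y : Fin 3 → ℝ) (a : ℝ) :
    polarForm F x (a • y) = a * polarForm F x y := by
  simp only [polarForm, Pi.smul_apply, smul_eq_mul, Fin.sum_univ_three]
  ring

lemma linearForm_induction {p : MvPolynomial (Fin 3) ℝ → Prop}
    (hX : ∀ i (r : ℝ), p (C r * X i)) (hadd : ∀ F G, p F → p G → p (F + G))
    {L : MvPolynomial (Fin 3) ℝ} (hL : L.IsHomogeneous 1) : p L := by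
  have h : L ∈ homogeneousSubmodule (Fin 3) ℝ 1 := hL
  rw [homogeneousSubmodule_one_eq_span_X, Submodule.mem_span_range_iff_exists_fun] at h
  obtain ⟨c, rfl⟩ := h
  simp only [Fin.sum_univ_three, smul_eq_C_mul]
  exact hadd _ _ (hadd _ _ (hX _ _) (hX _ _)) (hX _ _)

/-- Cubic forms are sums of products of three linear forms, so an identity additive in F need only
be checked on such products, where the Leibniz rule settles it. -/
lemma cubicForm_induction {p : MvPolynomial (Fin 3) ℝ → Prop}
    (hmul : ∀ K L M : MvPolynomial (Fin 3) ℝ, K.IsHomogeneous 1 → L.IsHomogeneous 1 →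
      M.IsHomogeneous 1 → p (K * L * M))
    (hadd : ∀ F G, p F → p G → p (F + G))
    {F : MvPolynomial (Fin 3) ℝ} (hF : F.IsHomogeneous 3) : p F := by
  have h : F ∈ homogeneousSubmodule (Fin 3) ℝ 3 := hF
  rw [← homogeneousSubmodule_one_pow, pow_succ, pow_two] at h
  refine Submodule.mul_induction_on h (fun m hm n hn => ?_) hadd
  refine Submodule.mul_induction_on hm (fun k hk l hl => hmul k l n hk hl hn) ?_
  intro u v hu hv
  rw [add_mul]
  exact hadd _ _ hu hv

lemma eval_linearForm_comb {L : MvPolynomial (Fin 3) ℝ} (hL : L.IsHomogeneous 1)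
    (x y : Fin 3 → ℝ) (a b : ℝ) :
    eval (a • x + b • y) L = a * eval x L + b * eval y L := by
  refine linearForm_induction (p := fun L => eval (a • x + b • y) L = a * eval x L + b * eval y L)
    (fun i r => ?_) (fun F G hF hG => ?_) hL
  · simp; ring
  · simp only [map_add, hF, hG]; ring

lemma polarForm_linearForm {L : MvPolynomial (Fin 3) ℝ} (hL : L.IsHomogeneous 1)
    (x y : Fin 3 → ℝ) : polarForm L x y = eval y L := by
  refine linearForm_induction (p := fun L => polarForm L x y = eval y L)
    (fun i r => ?_) (fun F G hF hG => ?_) hL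
  · fin_cases i <;> simp [polarForm, Fin.sum_univ_three, pderiv_X]
  · rw [polarForm_add, hF, hG, map_add]

/-- This is the Taylor expansion along a line. In degree three the quadratic coefficient is again a
polar, with the two points exchanged. -/
lemma eval_cubicForm_comb {F : MvPolynomial (Fin 3) ℝ} (hF : F.IsHomogeneous 3)
    (x y : Fin 3 → ℝ) (a b : ℝ) :
    eval (a • x + b • y) F = a ^ 3 * eval x F + a ^ 2 * b * polarForm F x y +
      a * b ^ 2 * polarForm F y x + b ^ 3 * eval y F := by
  refine cubicForm_induction (p := fun F => eval (a • x + b • y) F = a ^ 3 * eval x F +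
    a ^ 2 * b * polarForm F x y + a * b ^ 2 * polarForm F y x + b ^ 3 * eval y F)
    (fun K L M hK hL hM => ?_) (fun F G hF hG => ?_) hF
  · simp only [polarForm_mul, polarForm_linearForm hK, polarForm_linearForm hL,
      polarForm_linearForm hM, map_mul, eval_linearForm_comb hK, eval_linearForm_comb hL,
      eval_linearForm_comb hM]
    ring
  · simp only [map_add, hF, hG, polarForm_add]; ring

lemma polarForm_smul_left {F : MvPolynomial (Fin 3) ℝ} (hF : F.IsHomogeneous 3)
    (x y : Fin 3 → ℝ) (a : ℝ) : polarForm F (a • x) y = a ^ 2 * polarForm F x y := by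
  refine cubicForm_induction (p := fun F => polarForm F (a • x) y = a ^ 2 * polarForm F x y)
    (fun K L M hK hL hM => ?_) (fun F G hF hG => ?_) hF
  · have e : ∀ {L : MvPolynomial (Fin 3) ℝ}, L.IsHomogeneous 1 → eval (a • x) L = a * eval x L :=
      fun hL => by simpa using eval_linearForm_comb hL x 0 a 0
    simp only [polarForm_mul, polarForm_linearForm hK, polarForm_linearForm hL,
      polarForm_linearForm hM, map_mul, e hK, e hL, e hM]
    ring
  · simp only [hF, hG, polarForm_add]; ring

lemma eval_cubicForm_smul {F : MvPolynomial (Fin 3) ℝ} (hF : F.IsHomogeneous 3)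
    (x : Fin 3 → ℝ) (a : ℝ) : eval (a • x) F = a ^ 3 * eval x F := by
  simpa using eval_cubicForm_comb hF x 0 a 0

lemma polarForm_self {F : MvPolynomial (Fin 3) ℝ} (hF : F.IsHomogeneous 3) (x : Fin 3 → ℝ) :
    polarForm F x x = 3 * eval x F := by
  have h := eval_cubicForm_comb hF x x 1 1
  rw [← add_smul, eval_cubicForm_smul hF] at h
  linarith

end CubicForm

/-! ### Points and lines in coordinates -/

section Points

open MvPolynomial Projectivization

variable {F : MvPolynomial (Fin 3) ℝ}

lemma exists_rep_mk_eq_smul {x : Fin 3 → ℝ} (hx : x ≠ 0) :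
    ∃ a : ℝ, a ≠ 0 ∧ (mk ℝ x hx).rep = a • x := by
  obtain ⟨a, ha⟩ := exists_smul_eq_mk_rep ℝ x hx
  exact ⟨a, a.ne_zero, ha.symm⟩

lemma mk_mem_curve (hF : F.IsHomogeneous 3) {x : Fin 3 → ℝ} (hx : x ≠ 0) :
    (mk ℝ x hx : RP2) ∈ curve F ↔ eval x F = 0 := by
  obtain ⟨a, ha, h⟩ := exists_rep_mk_eq_smul hx
  simp [curve, h, eval_cubicForm_smul hF, ha]

lemma isSingularPt_mk (hF : F.IsHomogeneous 3) {x : Fin 3 → ℝ} (hx : x ≠ 0) :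
    IsSingularPt F (mk ℝ x hx) ↔ ∀ y, polarForm F x y = 0 := by
  obtain ⟨a, ha, h⟩ := exists_rep_mk_eq_smul hx
  have key : IsSingularPt F (mk ℝ x hx) ↔ ∀ y, polarForm F (a • x) y = 0 := by
    rw [← h]
    constructor
    · intro hs y
      simp [polarForm, hs _]
    · intro hs i
      simpa [polarForm, Pi.single_apply] using hs (Pi.single i 1)
  rw [key]
  simp [polarForm_smul_left hF, ha]

lemma mem_tangentAt_mk (hF : F.IsHomogeneous 3) {x : Fin 3 → ℝ} (hx : x ≠ 0) (v : Fin 3 → ℝ) :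
    v ∈ tangentAt F (mk ℝ x hx) ↔ polarForm F x v = 0 := by
  obtain ⟨a, ha, h⟩ := exists_rep_mk_eq_smul hx
  have key : v ∈ tangentAt F (mk ℝ x hx) ↔ polarForm F (a • x) v = 0 := by
    rw [← h]; rfl
  rw [key]
  simp [polarForm_smul_left hF, ha]

lemma onLine_mk {x : Fin 3 → ℝ} (hx : x ≠ 0) (l : ProjLine) :
    OnLine (mk ℝ x hx) l ↔ x ∈ l := by
  rw [OnLine, submodule_mk, Submodule.span_singleton_le_iff_mem]

lemma joinLine_mk {x y : Fin 3 → ℝ} (hx : x ≠ 0) (hy : y ≠ 0) :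
    joinLine (mk ℝ x hx) (mk ℝ y hy) = Submodule.span ℝ {x, y} := by
  rw [joinLine, submodule_mk, submodule_mk, Submodule.span_insert]

lemma restrictToLine_eq (hF : F.IsHomogeneous 3) (x v : Fin 3 → ℝ) :
    restrictToLine F x v = Polynomial.C (eval x F) + Polynomial.C (polarForm F x v) * .X +
      Polynomial.C (polarForm F v x) * .X ^ 2 + Polynomial.C (eval v F) * .X ^ 3 := by
  refine Polynomial.funext fun t => ?_
  have h := eval_cubicForm_comb hF x v 1 t
  have : Polynomial.eval t (restrictToLine F x v) = eval ((1 : ℝ) • x + t • v) F := by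
    rw [restrictToLine, ← Polynomial.coe_evalRingHom, map_aeval]
    simp only [eval, coe_eval₂Hom, one_smul]
    congr 1
    · ext r; simp
    · ext i; simpa using mul_comm _ _
  rw [this, h]
  simp
  ring

lemma isInflectionPt_mk (hF : F.IsHomogeneous 3) {x : Fin 3 → ℝ} (hx : x ≠ 0) :
    IsInflectionPt F (mk ℝ x hx) ↔ eval x F = 0 ∧ (∃ y, polarForm F x y ≠ 0) ∧
      ∀ v, polarForm F x v = 0 → polarForm F v x = 0 := by
  obtain ⟨a, ha, h⟩ := exists_rep_mk_eq_smul hx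
  rw [IsInflectionPt, mk_mem_curve hF, isSingularPt_mk hF]
  push Not
  refine and_congr_right fun h0 => and_congr_right fun _ => forall_congr' fun v => ?_
  rw [mem_tangentAt_mk hF]
  refine imp_congr_right fun hv => ?_
  rw [h, restrictToLine_eq hF, Polynomial.X_pow_dvd_iff]
  constructor
  · intro hc
    -- The coefficients of degree 0 and 1 vanish already on the curve and its tangent; only degree 2
    -- carries information.
    have := hc 2 (by norm_num)
    simpa [Polynomial.coeff_X, Polynomial.coeff_C, Polynomial.coeff_C_mul, Polynomial.coeff_X_pow,
      polarForm_smul_right, ha, -map_mul] using this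
  · intro hc d hd
    interval_cases d <;>
    simp [Polynomial.coeff_C, polarForm_smul_right, polarForm_smul_left hF,
      eval_cubicForm_smul hF, h0, hv, hc]

end Points

/-! ### Third intersections from a factorisation on a line -/

section ThirdIntersection

open MvPolynomial Projectivization

/-- The vector with coordinates `p` with respect to `e`, `f`. -/
def comb (e f : Fin 3 → ℝ) (p : ℝ × ℝ) : Fin 3 → ℝ := p.1 • e + p.2 • f

/-- The determinant of two vectors of the plane. -/
def detPair (p q : ℝ × ℝ) : ℝ := p.1 * q.2 - p.2 * q.1

lemma detPair_self (p : ℝ × ℝ) : detPair p p = 0 := by simp [detPair, mul_comm]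

lemma detPair_comm_eq_zero {p q : ℝ × ℝ} (h : detPair p q = 0) : detPair q p = 0 := by
  simp only [detPair] at *; linarith

lemma exists_detPair_ne_zero {p : ℝ × ℝ} (hp : p ≠ 0) : ∃ q, detPair q p ≠ 0 := by
  by_contra! h
  apply hp
  have h1 := h (1, 0)
  have h2 := h (0, 1)
  simp [detPair] at h1 h2
  exact Prod.ext h2 h1

lemma detPair_eq_zero_trans {p q r : ℝ × ℝ} (hp : p ≠ 0) (hq : detPair p q = 0) (hr : detPair p r = 0) :
    detPair q r = 0 := by
  by_contra h
  apply hp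
  simp only [detPair] at *
  have h1 : p.1 * (q.1 * r.2 - q.2 * r.1) = 0 := by linear_combination q.1 * hr - r.1 * hq
  have h2 : p.2 * (q.1 * r.2 - q.2 * r.1) = 0 := by linear_combination q.2 * hr - r.2 * hq
  exact Prod.ext (by simpa [h] using h1) (by simpa [h] using h2)

variable {F : MvPolynomial (Fin 3) ℝ} {e f : Fin 3 → ℝ}

lemma ne_zero_of_comb_ne_zero {p : ℝ × ℝ} (h : comb e f p ≠ 0) : p ≠ 0 := by
  rintro rfl; simp [comb] at h

lemma comb_mem_span (e f : Fin 3 → ℝ) (p : ℝ × ℝ) : comb e f p ∈ Submodule.span ℝ {e, f} :=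
  Submodule.mem_span_pair.2 ⟨p.1, p.2, rfl⟩

lemma mk_comb_eq_iff (hef : LinearIndependent ℝ ![e, f]) {p q : ℝ × ℝ} (hp : comb e f p ≠ 0)
    (hq : comb e f q ≠ 0) :
    (mk ℝ (comb e f p) hp : RP2) = mk ℝ (comb e f q) hq ↔ detPair p q = 0 := by
  rw [mk_eq_mk_iff']
  constructor
  · rintro ⟨a, h⟩
    have h' : (a * q.1 - p.1) • e + (a * q.2 - p.2) • f = 0 := by
      rw [← sub_eq_zero] at h
      rw [← h]
      simp only [comb]
      module
    obtain ⟨h1, h2⟩ := LinearIndependent.pair_iff.1 hef _ _ h'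
    simp only [detPair]
    linear_combination q.1 * h2 - q.2 * h1
  · intro h
    have hq0 := ne_zero_of_comb_ne_zero hq
    have hd : q.1 ^ 2 + q.2 ^ 2 ≠ 0 := by
      intro h0
      apply hq0
      exact Prod.ext (pow_eq_zero_iff two_ne_zero |>.1 (by nlinarith [sq_nonneg q.1, sq_nonneg q.2]))
        (pow_eq_zero_iff two_ne_zero |>.1 (by nlinarith [sq_nonneg q.1, sq_nonneg q.2]))
    simp only [detPair] at h
    refine ⟨(p.1 * q.1 + p.2 * q.2) / (q.1 ^ 2 + q.2 ^ 2), ?_⟩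
    simp only [comb, smul_add, smul_smul]
    congr 2
    · field_simp; linear_combination (-q.2) * h
    · field_simp; linear_combination (q.1) * h

lemma finrank_span_pair (hef : LinearIndependent ℝ ![e, f]) :
    Module.finrank ℝ (Submodule.span ℝ {e, f}) = 2 := by
  have := finrank_span_eq_card hef
  rwa [Matrix.range_cons_cons_empty, Fintype.card_fin] at this

lemma span_comb_eq (hef : LinearIndependent ℝ ![e, f]) {p q : ℝ × ℝ} (h : detPair p q ≠ 0) :
    Submodule.span ℝ {comb e f p, comb e f q} = Submodule.span ℝ {e, f} := by
  apply le_antisymm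
  · rw [Submodule.span_le]
    rintro x (rfl | rfl) <;> exact comb_mem_span _ _ _
  · rw [Submodule.span_le]
    rintro x (rfl | rfl)
    · refine Submodule.mem_span_pair.2 ⟨q.2 / detPair p q, -p.2 / detPair p q, ?_⟩
      have h1 : q.2 / detPair p q * p.1 + -p.2 / detPair p q * q.1 = 1 := by
        field_simp; simp only [detPair]; ring
      have h2 : q.2 / detPair p q * p.2 + -p.2 / detPair p q * q.2 = 0 := by
        field_simp; ring
      calc _ = (q.2 / detPair p q * p.1 + -p.2 / detPair p q * q.1) • x +
          (q.2 / detPair p q * p.2 + -p.2 / detPair p q * q.2) • f := by simp only [comb]; module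
        _ = x := by rw [h1, h2]; simp
    · refine Submodule.mem_span_pair.2 ⟨-q.1 / detPair p q, p.1 / detPair p q, ?_⟩
      have h1 : -q.1 / detPair p q * p.1 + p.1 / detPair p q * q.1 = 0 := by
        field_simp; ring
      have h2 : -q.1 / detPair p q * p.2 + p.1 / detPair p q * q.2 = 1 := by
        field_simp; simp only [detPair]; ring
      calc _ = (-q.1 / detPair p q * p.1 + p.1 / detPair p q * q.1) • e +
          (-q.1 / detPair p q * p.2 + p.1 / detPair p q * q.2) • x := by simp only [comb]; module
        _ = x := by rw [h1, h2]; simp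

lemma finrank_tangentAt {X : RP2} (h : ¬ IsSingularPt F X) :
    Module.finrank ℝ (tangentAt F X) = 2 := by
  let φ : (Fin 3 → ℝ) →ₗ[ℝ] ℝ :=
    ∑ i, eval X.rep (pderiv i F) • LinearMap.proj i
  have hφ : tangentAt F X = LinearMap.ker φ := by
    ext v
    simp [φ, tangentAt, LinearMap.mem_ker, LinearMap.sum_apply]
  have hne : φ ≠ 0 := by
    intro h0
    apply h
    intro i
    have := LinearMap.congr_fun h0 (Pi.single i 1)
    simpa [φ, LinearMap.sum_apply, Pi.single_apply] using this
  have hr : Module.finrank ℝ (LinearMap.range φ) = 1 := by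
    rw [LinearMap.range_eq_top.2 (LinearMap.surjective hne)]; simp
  have := LinearMap.finrank_range_add_finrank_ker φ
  rw [hφ]
  simp [hr] at this
  omega

lemma tangentAt_eq_span (hF : F.IsHomogeneous 3) (hef : LinearIndependent ℝ ![e, f])
    {x : Fin 3 → ℝ} (hx : x ≠ 0) (hs : ¬ IsSingularPt F (mk ℝ x hx))
    (he : polarForm F x e = 0) (hf : polarForm F x f = 0) :
    tangentAt F (mk ℝ x hx) = Submodule.span ℝ {e, f} := by
  symm
  apply Submodule.eq_of_le_of_finrank_eq
  · rw [Submodule.span_le]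
    rintro v (rfl | rfl)
    · exact (mem_tangentAt_mk hF hx _).2 he
    · exact (mem_tangentAt_mk hF hx _).2 hf
  · rw [finrank_span_pair hef, finrank_tangentAt hs]

lemma polarForm_comb_of_factor (hF : F.IsHomogeneous 3) {κ : ℝ} {x y z : ℝ × ℝ}
    (hg : ∀ p, eval (comb e f p) F = κ * detPair p x * detPair p y * detPair p z) (p q : ℝ × ℝ) :
    polarForm F (comb e f p) (comb e f q) = κ * (detPair q x * detPair p y * detPair p z +
      detPair p x * detPair q y * detPair p z + detPair p x * detPair p y * detPair q z) := by
  -- Half the difference of the values at p + q and p - q is the polar plus the value at q.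
  have h1 := eval_cubicForm_comb hF (comb e f p) (comb e f q) 1 1
  have h2 := eval_cubicForm_comb hF (comb e f p) (comb e f q) 1 (-1)
  have e1 : (1 : ℝ) • comb e f p + (1 : ℝ) • comb e f q = comb e f (p + q) := by
    simp only [comb, Prod.fst_add, Prod.snd_add]; module
  have e2 : (1 : ℝ) • comb e f p + (-1 : ℝ) • comb e f q = comb e f (p - q) := by
    simp only [comb, Prod.fst_sub, Prod.snd_sub]; module
  rw [e1, hg, hg, hg] at h1
  rw [e2, hg, hg, hg] at h2
  simp only [detPair, Prod.fst_add, Prod.snd_add, Prod.fst_sub, Prod.snd_sub] at *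
  linear_combination (-1 / 2) * h1 + (1 / 2) * h2

/-- On a line that meets the cubic in `x`, `y`, `z`, the point `z` is regular if `x`, `y` are. -/
lemma not_isSingularPt_of_factor (hF : F.IsHomogeneous 3) (hef : LinearIndependent ℝ ![e, f])
    {κ : ℝ} (hκ : κ ≠ 0) {x y z : ℝ × ℝ}
    (hg : ∀ p, eval (comb e f p) F = κ * detPair p x * detPair p y * detPair p z)
    (hx : comb e f x ≠ 0) (hy : comb e f y ≠ 0) (hz : comb e f z ≠ 0)
    (hsx : ¬ IsSingularPt F (mk ℝ _ hx)) (hsy : ¬ IsSingularPt F (mk ℝ _ hy)) :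
    ¬ IsSingularPt F (mk ℝ _ hz) := by
  intro hs
  -- A singular point is a multiple root on every line through it, so z would coincide with x or y.
  obtain ⟨q, hq⟩ := exists_detPair_ne_zero (ne_zero_of_comb_ne_zero hz)
  have h := (isSingularPt_mk hF hz).1 hs (comb e f q)
  rw [polarForm_comb_of_factor hF hg] at h
  simp only [detPair_self, mul_zero, zero_add, mul_eq_zero, hκ, hq, false_or, or_false] at h
  rcases h with h | h
  · rw [(mk_comb_eq_iff hef hz hx).2 h] at hs; exact hsx hs
  · rw [(mk_comb_eq_iff hef hz hy).2 h] at hs; exact hsy hs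

/-- In the derivative at the root x only the term that differentiates the factor of x survives, so
tangency means that x is a multiple root. -/
lemma tangentAt_comb_eq_span_iff (hF : F.IsHomogeneous 3) (hef : LinearIndependent ℝ ![e, f])
    {κ : ℝ} (hκ : κ ≠ 0) {x y z : ℝ × ℝ}
    (hg : ∀ p, eval (comb e f p) F = κ * detPair p x * detPair p y * detPair p z)
    (hx : comb e f x ≠ 0) (hs : ¬ IsSingularPt F (mk ℝ _ hx)) :
    tangentAt F (mk ℝ _ hx) = Submodule.span ℝ {e, f} ↔ detPair x y * detPair x z = 0 := by
  constructor
  · intro h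
    obtain ⟨q, hq⟩ := exists_detPair_ne_zero (ne_zero_of_comb_ne_zero hx)
    have hm := h.symm ▸ comb_mem_span e f q
    rw [mem_tangentAt_mk hF, polarForm_comb_of_factor hF hg] at hm
    simpa [detPair_self, hκ, hq] using hm
  · intro h
    have key : ∀ q, polarForm F (comb e f x) (comb e f q) = 0 := by
      intro q
      rw [polarForm_comb_of_factor hF hg]
      simp only [detPair_self]
      linear_combination κ * detPair q x * h
    refine tangentAt_eq_span hF hef hx hs ?_ ?_
    · simpa [comb] using key (1, 0)
    · simpa [comb] using key (0, 1)

lemma exists_comb_of_mem_span {v : Fin 3 → ℝ} (h : v ∈ Submodule.span ℝ {e, f}) :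
    ∃ p, v = comb e f p := by
  obtain ⟨a, b, rfl⟩ := Submodule.mem_span_pair.1 h
  exact ⟨(a, b), rfl⟩

lemma mem_curve_onLine_iff (hF : F.IsHomogeneous 3) (hef : LinearIndependent ℝ ![e, f])
    {κ : ℝ} (hκ : κ ≠ 0) {x y z : ℝ × ℝ}
    (hg : ∀ p, eval (comb e f p) F = κ * detPair p x * detPair p y * detPair p z)
    (hx : comb e f x ≠ 0) (hy : comb e f y ≠ 0) (hz : comb e f z ≠ 0) (T : RP2) :
    (T ∈ curve F ∧ OnLine T (Submodule.span ℝ {e, f})) ↔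
      T = mk ℝ _ hx ∨ T = mk ℝ _ hy ∨ T = mk ℝ _ hz := by
  constructor
  · induction T using Projectivization.ind with
    | h t ht =>
      rintro ⟨h1, h2⟩
      rw [onLine_mk] at h2
      obtain ⟨p, rfl⟩ := exists_comb_of_mem_span h2
      rw [mk_mem_curve hF, hg] at h1
      rw [mk_comb_eq_iff hef, mk_comb_eq_iff hef, mk_comb_eq_iff hef]
      simpa [hκ, or_assoc] using h1
  · rintro (rfl | rfl | rfl) <;>
    exact ⟨(mk_mem_curve hF _).2 (by simp [hg, detPair_self]), (onLine_mk _ _).2 (comb_mem_span _ _ _)⟩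

lemma onLine_tangentAt (hF : F.IsHomogeneous 3) {T : RP2} (hT : T ∈ curve F) :
    OnLine T (tangentAt F T) := by
  induction T using Projectivization.ind with
  | h t ht =>
    rw [mk_mem_curve hF] at hT
    rw [onLine_mk, mem_tangentAt_mk hF, polarForm_self hF, hT, mul_zero]

/-- The factors record the roots with multiplicity, a tangent being a double root and an inflection
a triple one. Each clause of the definition therefore selects the factor left after one x and one y
are removed. -/
theorem isThirdIntersection_iff_of_factor (hF : F.IsHomogeneous 3)
    (hef : LinearIndependent ℝ ![e, f]) {κ : ℝ} (hκ : κ ≠ 0) {x y z : ℝ × ℝ}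
    (hg : ∀ p, eval (comb e f p) F = κ * detPair p x * detPair p y * detPair p z)
    (hx : comb e f x ≠ 0) (hy : comb e f y ≠ 0) (hz : comb e f z ≠ 0)
    (hsx : ¬ IsSingularPt F (mk ℝ _ hx)) (hsy : ¬ IsSingularPt F (mk ℝ _ hy)) (Z : RP2) :
    IsThirdIntersection F (mk ℝ _ hx) (mk ℝ _ hy) Z ↔ Z = mk ℝ _ hz := by
  have hsz := not_isSingularPt_of_factor hF hef hκ hg hx hy hz hsx hsy
  have hgy : ∀ p, eval (comb e f p) F = κ * detPair p y * detPair p x * detPair p z :=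
    fun p => by rw [hg]; ring
  have hgz : ∀ p, eval (comb e f p) F = κ * detPair p z * detPair p x * detPair p y :=
    fun p => by rw [hg]; ring
  have hpts := mem_curve_onLine_iff hF hef hκ hg hx hy hz
  simp only [IsThirdIntersection, hsx, hsy, false_and, false_or, not_false_iff, true_and]
  by_cases hxy : detPair x y = 0
  · have hXY := (mk_comb_eq_iff hef hx hy).2 hxy
    have htan := (tangentAt_comb_eq_span_iff hF hef hκ hg hx hsx).2 (by rw [hxy, zero_mul])
    have hinf : IsInflectionPt F (mk ℝ _ hx) ↔ detPair x z = 0 := by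
      rw [isInflectionPt_mk hF]
      constructor
      · rintro ⟨-, -, h⟩
        obtain ⟨q, hq⟩ := exists_detPair_ne_zero (ne_zero_of_comb_ne_zero hx)
        have h1 := h (comb e f q) ((mem_tangentAt_mk hF hx _).1 (htan.symm ▸ comb_mem_span e f q))
        rw [polarForm_comb_of_factor hF hg] at h1
        have hq' : detPair q y ≠ 0 := fun h0 => hq <| detPair_comm_eq_zero <|
          detPair_eq_zero_trans (ne_zero_of_comb_ne_zero hy) (detPair_comm_eq_zero hxy)
            (detPair_comm_eq_zero h0)
        simpa [detPair_self, hxy, hκ, hq, hq'] using h1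
      · intro h
        refine ⟨by simp [hg, detPair_self], ?_, fun v hv => ?_⟩
        · rw [isSingularPt_mk hF] at hsx; push Not at hsx; exact hsx
        · have hv' := (mem_tangentAt_mk hF hx _).2 hv
          rw [htan] at hv'
          obtain ⟨q, rfl⟩ := exists_comb_of_mem_span hv'
          rw [polarForm_comb_of_factor hF hg]
          simp [detPair_self, hxy, h]
    rw [htan, hinf, ← mk_comb_eq_iff hef hx hz, ← hXY]
    rw [← hXY] at hpts
    simp only [ne_eq, not_true_eq_false, false_and, true_and, false_or]
    constructor
    · rintro (⟨h1, h2, h3, h4⟩ | ⟨h1, rfl⟩)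
      · rcases (hpts Z).1 ⟨h2, h3⟩ with h | h | h
        · exact absurd h h4
        · exact absurd h h4
        · exact h
      · exact h1
    · rintro rfl
      by_cases h : (mk ℝ _ hx : RP2) = mk ℝ _ hz
      · exact Or.inr ⟨h, h.symm⟩
      · obtain ⟨h2, h3⟩ := (hpts _).2 (Or.inr (Or.inr rfl))
        exact Or.inl ⟨h, h2, h3, fun h' => h h'.symm⟩
  · have hXY : (mk ℝ _ hx : RP2) ≠ mk ℝ _ hy := fun h => hxy ((mk_comb_eq_iff hef hx hy).1 h)
    -- A tangency point is a multiple root; as x and y differ, the repetition must involve z.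
    have htg : ∀ T, IsTangencyPt F (Submodule.span ℝ {e, f}) T ↔
        T = mk ℝ _ hz ∧ (T = mk ℝ _ hx ∨ T = mk ℝ _ hy) := by
      intro T
      constructor
      · rintro ⟨h1, -, h3⟩
        rcases (hpts T).1 ⟨h1, h3 ▸ onLine_tangentAt hF h1⟩ with rfl | rfl | rfl
        · rw [tangentAt_comb_eq_span_iff hF hef hκ hg hx hsx] at h3
          exact ⟨(mk_comb_eq_iff hef _ _).2 (by simpa [hxy] using h3), Or.inl rfl⟩
        · rw [tangentAt_comb_eq_span_iff hF hef hκ hgy hy hsy] at h3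
          have hyx : detPair y x ≠ 0 := fun h => hxy (detPair_comm_eq_zero h)
          exact ⟨(mk_comb_eq_iff hef _ _).2 (by simpa [hyx] using h3), Or.inr rfl⟩
        · rw [tangentAt_comb_eq_span_iff hF hef hκ hgz hz hsz] at h3
          refine ⟨rfl, ?_⟩
          rw [mk_comb_eq_iff hef, mk_comb_eq_iff hef]
          simpa using h3
      · rintro ⟨rfl, h⟩
        refine ⟨((hpts _).2 (Or.inr (Or.inr rfl))).1, hsz, ?_⟩
        rw [tangentAt_comb_eq_span_iff hF hef hκ hgz hz hsz]
        rw [mk_comb_eq_iff hef, mk_comb_eq_iff hef] at h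
        simpa using h
    have hjoin : joinLine (mk ℝ _ hx) (mk ℝ _ hy) = Submodule.span ℝ {e, f} := by
      rw [joinLine_mk, span_comb_eq hef hxy]
    rw [hjoin]
    simp only [htg, hXY, ne_eq, not_false_iff, true_and, false_and, or_false]
    constructor
    · rintro (⟨-, h2, h3, h4, h5⟩ | ⟨h, -⟩)
      · simpa [h4, h5] using (hpts Z).1 ⟨h2, h3⟩
      · exact h
    · rintro rfl
      by_cases h : (mk ℝ _ hz : RP2) = mk ℝ _ hx ∨ (mk ℝ _ hz : RP2) = mk ℝ _ hy
      · exact Or.inr ⟨rfl, h⟩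
      · obtain ⟨h2, h3⟩ := (hpts _).2 (Or.inr (Or.inr rfl))
        push Not at h
        refine Or.inl ⟨?_, h2, h3, h.1, h.2⟩
        rintro ⟨T, rfl, h'⟩
        tauto

end ThirdIntersection

/-! ### Divisibility of forms from inclusion of zero sets -/

section Divisibility

open MvPolynomial

lemma exists_root_of_monic_cubic (b c d : ℝ) : ∃ t : ℝ, t ^ 3 + b * t ^ 2 + c * t + d = 0 := by
  -- With this choice T ^ 3 - T ^ 2 = (|b| + |c| + |d|) * T ^ 2, so the leading term dominates at ±T
  -- and the cubic changes sign on [-T, T].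
  set T := 1 + |b| + |c| + |d| with hT
  have hb := abs_nonneg b
  have hc := abs_nonneg c
  have hd := abs_nonneg d
  have hT1 : 1 ≤ T := by linarith
  have hT2 : T ≤ T ^ 2 := by nlinarith
  have e1 : |b * T ^ 2| ≤ |b| * T ^ 2 := by rw [abs_mul, abs_of_nonneg (sq_nonneg T)]
  have e2 : |c * T| ≤ |c| * T ^ 2 := by
    rw [abs_mul, abs_of_nonneg (by linarith : 0 ≤ T)]
    exact mul_le_mul_of_nonneg_left hT2 hc
  have e3 : |d| ≤ |d| * T ^ 2 := by nlinarith
  have e4 : |b| * T ^ 2 + |c| * T ^ 2 + |d| * T ^ 2 = T ^ 3 - T ^ 2 := by rw [hT]; ring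
  obtain ⟨b1, b2⟩ := abs_le.1 e1
  obtain ⟨c1, c2⟩ := abs_le.1 e2
  obtain ⟨d1, d2⟩ := abs_le.1 e3
  have hcont : ContinuousOn (fun t : ℝ => t ^ 3 + b * t ^ 2 + c * t + d) (Set.Icc (-T) T) := by
    fun_prop
  obtain ⟨t, -, ht⟩ := intermediate_value_Icc (by linarith) hcont
    (show (0 : ℝ) ∈ _ from ⟨by nlinarith, by nlinarith⟩)
  exact ⟨t, ht⟩

lemma exists_root_of_cubic {a : ℝ} (ha : a ≠ 0) (b c d : ℝ) :
    ∃ t : ℝ, a * t ^ 3 + b * t ^ 2 + c * t + d = 0 := by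
  obtain ⟨t, ht⟩ := exists_root_of_monic_cubic (b / a) (c / a) (d / a)
  refine ⟨t, ?_⟩
  field_simp at ht
  linarith

/-- Real zeros suffice because, by `h0`, F has odd degree three in the first variable: over every
value of the other two it has a real root, shared by G. The resultant in the first variable thus
vanishes everywhere and is zero, whereas coprimality over the fraction field would make it nonzero.
Gauss's lemma brings divisibility back from that field. -/
theorem dvd_of_zeros_subset {F G : MvPolynomial (Fin 3) ℝ} (hF : F.IsHomogeneous 3)
    (hirr : Irreducible F) (h0 : eval ![1, 0, 0] F ≠ 0)
    (hFG : ∀ v, eval v F = 0 → eval v G = 0) : F ∣ G := by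
  set f := finSuccEquiv ℝ 2 F with hf
  set g := finSuccEquiv ℝ 2 G with hg
  have hcons : ∀ (t : ℝ) (s : Fin 2 → ℝ), (Fin.cons t s : Fin 3 → ℝ) =
      t • ![1, 0, 0] + (1 : ℝ) • (Fin.cons 0 s : Fin 3 → ℝ) := by
    intro t s
    ext i
    refine Fin.cases ?_ (fun j => ?_) i
    · simp
    · fin_cases j <;> simp <;> rfl
  have hfirr : Irreducible f := (MulEquiv.irreducible_iff (finSuccEquiv ℝ 2)).2 hirr
  have hdeg : f.natDegree ≠ 0 := by
    intro h
    obtain ⟨p, hp⟩ := Polynomial.natDegree_eq_zero.1 h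
    have key : ∀ t : ℝ, eval (Fin.cons t 0 : Fin 3 → ℝ) F = eval 0 p := by
      intro t
      have := eval_eq_eval_mv_eval' (0 : Fin 2 → ℝ) t F
      rw [← hf, ← hp] at this
      simpa using this
    have k2 : ∀ t : ℝ, t ^ 3 * eval ![1, 0, 0] F = eval 0 p := by
      intro t
      rw [← key t, hcons, ← eval_cubicForm_smul hF]
      congr 2
      ext i
      refine Fin.cases ?_ (fun j => ?_) i
      · simp
      · fin_cases j <;> simp <;> rfl
    have a0 := k2 0
    have a1 := k2 1
    apply h0
    linarith
  have hprim : f.IsPrimitive := hfirr.isPrimitive hdeg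
  let K := FractionRing (MvPolynomial (Fin 2) ℝ)
  have hinj : Function.Injective (algebraMap (MvPolynomial (Fin 2) ℝ) K) :=
    IsFractionRing.injective _ _
  have hKirr : Irreducible (f.map (algebraMap _ K)) :=
    hprim.irreducible_iff_irreducible_map_fraction_map.1 hfirr
  by_contra hnd
  have hnd' : ¬ f.map (algebraMap _ K) ∣ g.map (algebraMap _ K) := by
    intro h
    have h1 := hprim.dvd_of_fraction_map_dvd_fraction_map h
    exact hnd ((map_dvd_iff (finSuccEquiv ℝ 2)).1 h1)
  have hcop := hKirr.coprime_iff_not_dvd.2 hnd'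
  have hres : f.resultant g ≠ 0 := by
    intro h
    have h2 := Polynomial.resultant_map_map f g f.natDegree g.natDegree
      (algebraMap (MvPolynomial (Fin 2) ℝ) K)
    rw [h, map_zero] at h2
    have h3 : Polynomial.resultant (f.map (algebraMap _ K)) (g.map (algebraMap _ K)) = 0 := by
      rw [← h2, Polynomial.natDegree_map_eq_of_injective hinj,
        Polynomial.natDegree_map_eq_of_injective hinj]
    exact (Polynomial.resultant_eq_zero_iff.1 h3).2 hcop
  obtain ⟨p, q, -, -, hpq⟩ := Polynomial.exists_mul_add_mul_eq_C_resultant f g le_rfl le_rfl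
    (Or.inl hdeg)
  apply hres
  refine MvPolynomial.funext fun s => ?_
  rw [map_zero]
  obtain ⟨t, ht⟩ := exists_root_of_cubic h0 (polarForm F ![1, 0, 0] (Fin.cons 0 s))
    (polarForm F (Fin.cons 0 s) ![1, 0, 0]) (eval (Fin.cons 0 s : Fin 3 → ℝ) F)
  have hFz : eval (Fin.cons t s : Fin 3 → ℝ) F = 0 := by
    rw [hcons, eval_cubicForm_comb hF]
    linarith
  have hGz := hFG _ hFz
  have e1 := eval_eq_eval_mv_eval' s t F
  have e2 := eval_eq_eval_mv_eval' s t G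
  have e3 := congrArg (fun r => Polynomial.eval t (Polynomial.map (eval s) r)) hpq
  simp only [Polynomial.map_add, Polynomial.map_mul, Polynomial.eval_add, Polynomial.eval_mul,
    Polynomial.map_C, Polynomial.eval_C] at e3
  rw [← e3]
  have e1' : Polynomial.eval t (Polynomial.map (eval s) f) = 0 := e1.symm.trans hFz
  have e2' : Polynomial.eval t (Polynomial.map (eval s) g) = 0 := e2.symm.trans hGz
  rw [e1', e2']
  ring

theorem dvd_of_zeros_subset' {F G : MvPolynomial (Fin 3) ℝ} (hF : F.IsHomogeneous 3)
    (hirr : Irreducible F) (h0 : eval ![0, 1, 0] F ≠ 0)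
    (hFG : ∀ v, eval v F = 0 → eval v G = 0) : F ∣ G := by
  let σ := renameEquiv ℝ (Equiv.swap (0 : Fin 3) 1)
  have he : ∀ (v : Fin 3 → ℝ) (H : MvPolynomial (Fin 3) ℝ),
      eval v (σ H) = eval (v ∘ Equiv.swap (0 : Fin 3) 1) H := by
    intro v H
    simp [σ, eval_rename]
  have : σ F ∣ σ G := by
    refine dvd_of_zeros_subset ?_ ((MulEquiv.irreducible_iff σ).2 hirr) ?_ ?_
    · exact hF.rename_isHomogeneous
    · rw [he]
      convert h0 using 2
      congr 1
      ext i; fin_cases i <;> rfl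
    · intro v hv
      rw [he] at *
      exact hFG _ hv
  exact (map_dvd_iff σ).1 this

/-- Two cubic forms, the first irreducible, with the same zeros are proportional. -/
theorem exists_eval_eq_mul_of_zeros {F G : MvPolynomial (Fin 3) ℝ} (hF : IsNondegenerateCubic F)
    (hG : G.IsHomogeneous 3) (hG0 : G ≠ 0)
    (h0 : eval ![1, 0, 0] F ≠ 0 ∨ eval ![0, 1, 0] F ≠ 0)
    (hFG : ∀ v, eval v F = 0 → eval v G = 0) :
    ∃ c : ℝ, c ≠ 0 ∧ ∀ v, eval v F = c * eval v G := by
  have hd : F ∣ G := h0.elim (fun h => dvd_of_zeros_subset hF.1 hF.2 h hFG)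
    (fun h => dvd_of_zeros_subset' hF.1 hF.2 h hFG)
  obtain ⟨H, rfl⟩ := hd
  have hF0 := hF.2.ne_zero
  have hH0 : H ≠ 0 := by rintro rfl; simp at hG0
  have ht := totalDegree_mul_of_isDomain hF0 hH0
  rw [hG.totalDegree hG0, hF.1.totalDegree hF0] at ht
  have hH : H = C (coeff 0 H) := totalDegree_eq_zero_iff_eq_C.1 (by omega)
  have hc : coeff 0 H ≠ 0 := by
    intro h; rw [h, C_0] at hH; exact hH0 hH
  refine ⟨(coeff 0 H)⁻¹, inv_ne_zero hc, fun v => ?_⟩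
  rw [map_mul, hH, eval_C, coeff_zero_C]
  field_simp

lemma not_dvd_of_isHomogeneous_one {F L : MvPolynomial (Fin 3) ℝ} (hF : IsNondegenerateCubic F)
    (hL : L.IsHomogeneous 1) : ¬ L ∣ F := by
  rintro ⟨H, rfl⟩
  have hF0 := hF.2.ne_zero
  have hL0 := left_ne_zero_of_mul hF0
  have hH0 := right_ne_zero_of_mul hF0
  have ht := totalDegree_mul_of_isDomain hL0 hH0
  rw [hF.1.totalDegree hF0, hL.totalDegree hL0] at ht
  rcases hF.2.isUnit_or_isUnit rfl with h | h
  · have := hL.totalDegree hL0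
    rw [isUnit_iff_totalDegree_of_isReduced] at h
    omega
  · rw [isUnit_iff_totalDegree_of_isReduced] at h
    omega

/-- Substituting 0 for `X 2` does not change the class modulo `X 2`, and here it yields a polynomial
vanishing at every point, hence zero. -/
lemma X_two_dvd_of_eval_eq_zero {F : MvPolynomial (Fin 3) ℝ}
    (h : ∀ x y : ℝ, eval ![x, y, 0] F = 0) : X 2 ∣ F := by
  let φ : MvPolynomial (Fin 3) ℝ →ₐ[ℝ] MvPolynomial (Fin 3) ℝ := aeval ![X 0, X 1, 0]
  let π := Ideal.Quotient.mkₐ ℝ (Ideal.span {(X 2 : MvPolynomial (Fin 3) ℝ)})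
  have h1 : π.comp φ = π := by
    ext i
    fin_cases i
    · simp [φ]
    · simp [φ]
    · have : π (X 2) = 0 := Ideal.Quotient.eq_zero_iff_mem.2 (Ideal.mem_span_singleton_self _)
      simp [φ, this]
  have h2 : φ F = 0 := by
    refine MvPolynomial.funext fun v => ?_
    rw [map_zero, ← h (v 0) (v 1)]
    change eval v (aeval ![X 0, X 1, 0] F) = _
    rw [map_aeval]
    simp only [eval, coe_eval₂Hom]
    congr 1
    · ext r; simp
    · ext i; fin_cases i <;> simp
  have h3 : π F = 0 := by rw [← h1, AlgHom.comp_apply, h2, map_zero]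
  exact Ideal.mem_span_singleton.1 (Ideal.Quotient.eq_zero_iff_mem.1 h3)

end Divisibility

/-! ### Isogonality in complex coordinates -/

section Isogonality

open Projectivization ComplexConjugate

/-- The vector `(z.re, z.im, w)`. -/
def hvec (z : ℂ) (w : ℝ) : Fin 3 → ℝ := ![z.re, z.im, w]

lemma hvec_inj {z z' : ℂ} {w w' : ℝ} : hvec z w = hvec z' w' ↔ z = z' ∧ w = w' := by
  constructor
  · intro h
    have h0 := congrFun h 0
    have h1 := congrFun h 1
    have h2 := congrFun h 2
    simp [hvec] at h0 h1 h2
    exact ⟨Complex.ext h0 h1, h2⟩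
  · rintro ⟨rfl, rfl⟩; rfl

lemma hvec_zero : hvec 0 0 = 0 := by ext i; fin_cases i <;> simp [hvec]

lemma smul_hvec_add (a b : ℝ) (z z' : ℂ) (w w' : ℝ) :
    a • hvec z w + b • hvec z' w' = hvec (a * z + b * z') (a * w + b * w') := by
  ext i; fin_cases i <;> simp [hvec]

lemma smul_hvec (a : ℝ) (z : ℂ) (w : ℝ) : a • hvec z w = hvec (a * z) (a * w) := by
  ext i; fin_cases i <;> simp [hvec]

lemma hvec_surj (v : Fin 3 → ℝ) : hvec ⟨v 0, v 1⟩ (v 2) = v := by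
  ext i; fin_cases i <;> simp [hvec]

lemma hvec_one_ne_zero (z : ℂ) : hvec z 1 ≠ 0 := by
  rw [← hvec_zero, Ne, hvec_inj]; simp

lemma hvec_inf_ne_zero {d : ℂ} (hd : d ≠ 0) : hvec d 0 ≠ 0 := by
  rw [← hvec_zero, Ne, hvec_inj]; simp [hd]

/-- The point at infinity of direction `d`. -/
def infinitePt (d : ℂ) (hd : d ≠ 0) : RP2 := mk ℝ (hvec d 0) (hvec_inf_ne_zero hd)

lemma affinePt_eq_mk (z : ℂ) : affinePt z = mk ℝ (hvec z 1) (hvec_one_ne_zero z) := rfl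

lemma atInfinity_mk {z : ℂ} {w : ℝ} (h : hvec z w ≠ 0) :
    AtInfinity (mk ℝ (hvec z w) h) ↔ w = 0 := by
  obtain ⟨a, ha, h⟩ := exists_rep_mk_eq_smul h
  rw [AtInfinity, h]
  simp [hvec, ha]

lemma not_atInfinity_affinePt (z : ℂ) : ¬ AtInfinity (affinePt z) := by
  rw [affinePt_eq_mk, atInfinity_mk]; simp

lemma atInfinity_infinitePt {d : ℂ} (hd : d ≠ 0) : AtInfinity (infinitePt d hd) := by
  rw [infinitePt, atInfinity_mk]

lemma affinePt_injective : Function.Injective affinePt := by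
  intro z z' h
  rw [affinePt_eq_mk, affinePt_eq_mk, mk_eq_mk_iff'] at h
  obtain ⟨a, h⟩ := h
  rw [smul_hvec, hvec_inj] at h
  obtain ⟨h1, h2⟩ := h
  rw [mul_one] at h2
  simpa [h2] using h1.symm

lemma affinePt_ne_infinitePt (z : ℂ) {d : ℂ} (hd : d ≠ 0) : affinePt z ≠ infinitePt d hd :=
  fun h => not_atInfinity_affinePt z (h ▸ atInfinity_infinitePt hd)

lemma mk_hvec_of_ne_zero {z : ℂ} {w : ℝ} (h : hvec z w ≠ 0) (hw : w ≠ 0) :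
    (mk ℝ (hvec z w) h : RP2) = affinePt (z / w) := by
  rw [affinePt_eq_mk, mk_eq_mk_iff']
  refine ⟨w, ?_⟩
  rw [smul_hvec, hvec_inj]
  have : (w : ℂ) ≠ 0 := by exact_mod_cast hw
  exact ⟨by field_simp, by simp⟩

lemma point_cases (X : RP2) : (∃ z, X = affinePt z) ∨ ∃ d, ∃ hd : d ≠ 0, X = infinitePt d hd := by
  induction X using Projectivization.ind with
  | h v hv =>
    obtain ⟨z, w, rfl⟩ : ∃ z w, v = hvec z w := ⟨_, _, (hvec_surj v).symm⟩
    by_cases hw : w = 0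
    · subst hw
      refine Or.inr ⟨z, ?_, rfl⟩
      rintro rfl; exact hv hvec_zero
    · exact Or.inl ⟨_, mk_hvec_of_ne_zero hv hw⟩

lemma im_eq_zero_iff {z : ℂ} : z.im = 0 ↔ ∃ r : ℝ, z = r :=
  ⟨fun h => ⟨z.re, Complex.ext (by simp) (by simpa using h)⟩, by rintro ⟨r, rfl⟩; simp⟩

lemma mem_span_iff_im {v : ℂ} (hv : v ≠ 0) (x : ℂ) :
    x ∈ Submodule.span ℝ {v} ↔ (x / v).im = 0 := by
  rw [Submodule.mem_span_singleton, im_eq_zero_iff]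
  refine exists_congr fun r => ?_
  rw [Complex.real_smul, div_eq_iff hv]
  exact eq_comm

lemma infinitePt_eq_iff {d d' : ℂ} (hd : d ≠ 0) (hd' : d' ≠ 0) :
    infinitePt d hd = infinitePt d' hd' ↔ (d / d').im = 0 := by
  rw [← mem_span_iff_im hd', infinitePt, infinitePt, mk_eq_mk_iff', Submodule.mem_span_singleton]
  refine exists_congr fun r => ?_
  rw [smul_hvec, hvec_inj]
  simp

/-- The line through the affine point `z` in the direction `d`. -/
def dirLine (z d : ℂ) : ProjLine := Submodule.span ℝ {hvec z 1, hvec d 0}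

lemma hvec_mem_dirLine {z d : ℂ} (hd : d ≠ 0) (x : ℂ) (w : ℝ) :
    hvec x w ∈ dirLine z d ↔ ((x - w * z) / d).im = 0 := by
  rw [dirLine, Submodule.mem_span_pair, im_eq_zero_iff]
  constructor
  · rintro ⟨a, b, h⟩
    rw [smul_hvec_add, hvec_inj] at h
    obtain ⟨h1, h2⟩ := h
    refine ⟨b, ?_⟩
    rw [div_eq_iff hd, ← h1, ← h2]
    push_cast
    ring
  · rintro ⟨b, h⟩
    rw [div_eq_iff hd] at h
    refine ⟨w, b, ?_⟩
    rw [smul_hvec_add, hvec_inj]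
    exact ⟨by linear_combination -h, by ring⟩

lemma linearIndependent_dirLine (z : ℂ) {d : ℂ} (hd : d ≠ 0) :
    LinearIndependent ℝ ![hvec z 1, hvec d 0] := by
  rw [LinearIndependent.pair_iff]
  intro a b h
  rw [smul_hvec_add, ← hvec_zero, hvec_inj] at h
  obtain ⟨h1, h2⟩ := h
  have ha : a = 0 := by simpa using h2
  subst ha
  simpa [hd] using h1

lemma finrank_dirLine (z : ℂ) {d : ℂ} (hd : d ≠ 0) : Module.finrank ℝ (dirLine z d) = 2 :=
  finrank_span_pair (linearIndependent_dirLine z hd)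

lemma lineDirection_dirLine (z : ℂ) {d : ℂ} (hd : d ≠ 0) :
    lineDirection (dirLine z d) = Submodule.span ℝ {d} := by
  ext w
  rw [mem_span_iff_im hd]
  change hvec w 0 ∈ dirLine z d ↔ _
  rw [hvec_mem_dirLine hd]
  simp

lemma onLine_affinePt_dirLine (z x : ℂ) {d : ℂ} (hd : d ≠ 0) :
    OnLine (affinePt x) (dirLine z d) ↔ ((x - z) / d).im = 0 := by
  rw [affinePt_eq_mk, onLine_mk, hvec_mem_dirLine hd]
  simp

lemma joinLine_comm (X Y : RP2) : joinLine X Y = joinLine Y X := sup_comm _ _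

lemma joinLine_affinePt (z x : ℂ) : joinLine (affinePt z) (affinePt x) = dirLine z (x - z) := by
  rw [affinePt_eq_mk, affinePt_eq_mk, joinLine_mk, dirLine]
  apply le_antisymm <;> rw [Submodule.span_le] <;> rintro v (rfl | rfl)
  · exact Submodule.mem_span_pair.2 ⟨1, 0, by simp⟩
  · refine Submodule.mem_span_pair.2 ⟨1, 1, ?_⟩
    rw [smul_hvec_add, hvec_inj]; simp
  · exact Submodule.mem_span_pair.2 ⟨1, 0, by simp⟩
  · refine Submodule.mem_span_pair.2 ⟨-1, 1, ?_⟩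
    rw [smul_hvec_add, hvec_inj]; simp; ring

lemma joinLine_infinitePt (z : ℂ) {d : ℂ} (hd : d ≠ 0) :
    joinLine (affinePt z) (infinitePt d hd) = dirLine z d := by
  rw [affinePt_eq_mk, infinitePt, joinLine_mk, dirLine]

/-! ### Bisectors in terms of complex numbers -/

lemma reflection_span_apply {b : ℂ} (hb : b ≠ 0) (w : ℂ) :
    (Submodule.span ℝ {b}).reflection w = b * conj w / conj b := by
  have hb' : conj b ≠ 0 := by simpa using hb
  have hn : ((‖b‖ ^ 2 : ℝ) : ℂ) = b * conj b := by
    rw [Complex.mul_conj, Complex.normSq_eq_norm_sq]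
  have h0 : ((‖b‖ ^ 2 : ℝ) : ℂ) ≠ 0 := by rw [hn]; exact mul_ne_zero hb hb'
  have hin : ((inner ℝ b w : ℝ) : ℂ) = (conj b * w + b * conj w) / 2 := by
    rw [Complex.inner]
    apply Complex.ext <;> simp <;> ring
  have hp : (Submodule.span ℝ {b}).starProjection w = (conj b * w + b * conj w) / (2 * conj b) := by
    have h := Submodule.smul_starProjection_singleton (𝕜 := ℝ) (v := b) w
    simp only [Complex.real_smul, RCLike.ofReal_real_eq_id, id] at h
    rw [hn, hin] at h
    field_simp at h ⊢
    linear_combination h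
  rw [Submodule.reflection_apply, hp]
  field_simp
  simp only [nsmul_eq_mul]
  field_simp
  ring

/-- The reflection in b sends u to b ū / b̄. Its quotient by v becomes b² / (uv) after
multiplication by the positive real |b|² / |u|². -/
lemma isBisector_span_iff {u v b : ℂ} (hu : u ≠ 0) (hv : v ≠ 0) (hb : b ≠ 0) :
    IsBisector (Submodule.span ℝ {u}) (Submodule.span ℝ {v}) (Submodule.span ℝ {b}) ↔
      (b ^ 2 / (u * v)).im = 0 := by
  have hb' : conj b ≠ 0 := by simpa using hb
  have hu' : conj u ≠ 0 := by simpa using hu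
  have key : (Submodule.span ℝ {b}).reflection u ∈ Submodule.span ℝ {v} ↔
      (b ^ 2 / (u * v)).im = 0 := by
    rw [mem_span_iff_im hv, reflection_span_apply hb, im_eq_zero_iff, im_eq_zero_iff]
    have hr : ((Complex.normSq b / Complex.normSq u : ℝ) : ℂ) = b * conj b / (u * conj u) := by
      push_cast; rw [Complex.mul_conj, Complex.mul_conj]
    have hr' : ((Complex.normSq u / Complex.normSq b : ℝ) : ℂ) = u * conj u / (b * conj b) := by
      push_cast; rw [Complex.mul_conj, Complex.mul_conj]
    constructor
    · rintro ⟨r, h⟩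
      refine ⟨r * (Complex.normSq b / Complex.normSq u), ?_⟩
      rw [Complex.ofReal_mul, hr, ← h]
      field_simp
    · rintro ⟨r, h⟩
      refine ⟨r * (Complex.normSq u / Complex.normSq b), ?_⟩
      rw [Complex.ofReal_mul, hr', ← h]
      field_simp
  rw [← key]
  constructor
  · rintro ⟨-, h⟩
    exact (h u).1 (Submodule.mem_span_singleton_self u)
  · intro h
    refine ⟨finrank_span_singleton hb, fun w => ?_⟩
    obtain ⟨c, hc⟩ := Submodule.mem_span_singleton.1 h
    have hc0 : c ≠ 0 := by
      rintro rfl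
      rw [zero_smul] at hc
      exact hu ((LinearIsometryEquiv.map_eq_zero_iff _).1 hc.symm)
    constructor
    · intro hw
      obtain ⟨a, rfl⟩ := Submodule.mem_span_singleton.1 hw
      rw [map_smul]
      exact Submodule.smul_mem _ _ h
    · intro hw
      obtain ⟨a, ha⟩ := Submodule.mem_span_singleton.1 hw
      refine Submodule.mem_span_singleton.2 ⟨a / c, ?_⟩
      apply (Submodule.span ℝ {b}).reflection.injective
      rw [map_smul, ← hc, ← ha, smul_smul, div_mul_cancel₀ _ hc0]

lemma im_div_eq_zero_trans {x y z : ℂ} (hy : y ≠ 0) (h1 : (x / y).im = 0) (h2 : (y / z).im = 0) :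
    (x / z).im = 0 := by
  obtain ⟨r, hr⟩ := im_eq_zero_iff.1 h1
  obtain ⟨s, hs⟩ := im_eq_zero_iff.1 h2
  refine im_eq_zero_iff.2 ⟨r * s, ?_⟩
  rw [Complex.ofReal_mul, ← hr, ← hs]
  field_simp

lemma im_div_comm_eq_zero {x y : ℂ} (h : (x / y).im = 0) : (y / x).im = 0 := by
  obtain ⟨r, hr⟩ := im_eq_zero_iff.1 h
  refine im_eq_zero_iff.2 ⟨r⁻¹, ?_⟩
  rw [Complex.ofReal_inv, ← hr, inv_div]

/-- The bisecting directions b are those with b² a real multiple of the product of the two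
directions, so the pair of bisectors and that product up to a real factor determine each other. A
square root of u₁u₂ serves as test bisector. -/
lemma shareBisectors_iff {l₁ l₂ m₁ m₂ : ProjLine} {u₁ u₂ v₁ v₂ : ℂ} (hu₁ : u₁ ≠ 0) (hu₂ : u₂ ≠ 0)
    (hv₁ : v₁ ≠ 0) (hv₂ : v₂ ≠ 0) (h1 : lineDirection l₁ = Submodule.span ℝ {u₁})
    (h2 : lineDirection l₂ = Submodule.span ℝ {u₂}) (h3 : lineDirection m₁ = Submodule.span ℝ {v₁})
    (h4 : lineDirection m₂ = Submodule.span ℝ {v₂}) :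
    ShareBisectors l₁ l₂ m₁ m₂ ↔ (u₁ * u₂ / (v₁ * v₂)).im = 0 := by
  rw [ShareBisectors, h1, h2, h3, h4]
  constructor
  · intro h
    obtain ⟨b, hb'⟩ := IsAlgClosed.exists_pow_nat_eq (u₁ * u₂) two_pos
    have hb := hb'.symm
    have hb0 : b ≠ 0 := by
      rintro rfl
      apply mul_ne_zero hu₁ hu₂
      rw [hb]; simp
    have := (h (Submodule.span ℝ {b})).1 ((isBisector_span_iff hu₁ hu₂ hb0).2
      (by rw [← hb, div_self (mul_ne_zero hu₁ hu₂)]; simp))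
    rw [isBisector_span_iff hv₁ hv₂ hb0, ← hb] at this
    exact this
  · intro h b
    by_cases hfin : Module.finrank ℝ b = 1
    · obtain ⟨β, hβ, rfl⟩ : ∃ β : ℂ, β ≠ 0 ∧ b = Submodule.span ℝ {β} := by
        obtain ⟨β, hβ, hs⟩ := finrank_eq_one_iff'.1 hfin
        refine ⟨β, by simpa using hβ, ?_⟩
        ext w
        rw [Submodule.mem_span_singleton]
        constructor
        · intro hw
          obtain ⟨c, hc⟩ := hs ⟨w, hw⟩
          exact ⟨c, by simpa using congrArg Subtype.val hc⟩
        · rintro ⟨c, rfl⟩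
          exact Submodule.smul_mem _ _ β.2
      rw [isBisector_span_iff hu₁ hu₂ hβ, isBisector_span_iff hv₁ hv₂ hβ]
      exact ⟨fun h' => im_div_eq_zero_trans (mul_ne_zero hu₁ hu₂) h' h,
        fun h' => im_div_eq_zero_trans (mul_ne_zero hv₁ hv₂) h' (im_div_comm_eq_zero h)⟩
    · exact ⟨fun h' => absurd h'.1 hfin, fun h' => absurd h'.1 hfin⟩

lemma isogonal_affinePt_iff (z : ℂ) {u₁ u₂ v₁ v₂ : ℂ} (hu₁ : u₁ ≠ 0) (hu₂ : u₂ ≠ 0)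
    (hv₁ : v₁ ≠ 0) (hv₂ : v₂ ≠ 0) :
    Isogonal (affinePt z) (dirLine z u₁) (dirLine z u₂) (dirLine z v₁) (dirLine z v₂) ↔
      (u₁ * u₂ / (v₁ * v₂)).im = 0 := by
  rw [← shareBisectors_iff hu₁ hu₂ hv₁ hv₂ (lineDirection_dirLine z hu₁)
    (lineDirection_dirLine z hu₂) (lineDirection_dirLine z hv₁) (lineDirection_dirLine z hv₂)]
  simp [Isogonal, not_atInfinity_affinePt]

/-- Im (z / d) measures the offset across the direction d, so equality of the directed lengths is
one linear relation between the offsets of four parallel lines. -/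
lemma isogonal_infinitePt_iff {d : ℂ} (hd : d ≠ 0) (A B C D : ℂ) :
    Isogonal (infinitePt d hd) (dirLine A d) (dirLine C d) (dirLine B d) (dirLine D d) ↔
      ((A + C - B - D) / d).im = 0 := by
  have hId : Complex.I * d ≠ 0 := mul_ne_zero Complex.I_ne_zero hd
  simp only [Isogonal, atInfinity_infinitePt, not_true_eq_false, false_imp_iff, true_imp_iff,
    true_and, IsogonalAtInfinity]
  constructor
  · intro h
    -- `p z` is where the line through z of direction d meets the perpendicular to d at the origin;
    -- this single transversal gives the relation.
    let p : ℂ → ℂ := fun z => Complex.I * d * (z / d).im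
    have hk : ∀ z, OnLine (affinePt (p z)) (dirLine 0 (Complex.I * d)) := by
      intro z
      rw [onLine_affinePt_dirLine _ _ hId, im_eq_zero_iff]
      exact ⟨(z / d).im, by simp only [p]; field_simp; ring⟩
    have hl : ∀ z, OnLine (affinePt (p z)) (dirLine z d) := by
      intro z
      rw [onLine_affinePt_dirLine _ _ hd]
      have : (p z - z) / d = Complex.I * (z / d).im - z / d := by simp only [p]; field_simp
      rw [this]; simp
    have hn : ¬ OnLine (infinitePt d hd) (dirLine 0 (Complex.I * d)) := by
      rw [infinitePt, onLine_mk, hvec_mem_dirLine hId]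
      have : (d - (0 : ℝ) * 0) / (Complex.I * d) = -Complex.I := by
        field_simp; simp
      rw [this]; simp
    have key := h _ (finrank_dirLine 0 hId) hn (p A) (p B) (p C) (p D) (hk A) (hk B) (hk C) (hk D)
      (hl A) (hl B) (hl C) (hl D)
    simp only [p, ← mul_sub] at key
    have k2 := mul_left_cancel₀ hId key
    have k3 : (B / d).im - (A / d).im = (C / d).im - (D / d).im := by exact_mod_cast k2
    simp only [sub_div, add_div, Complex.sub_im, Complex.add_im]
    linarith
  · intro h k _ hk E G C' H hE hG hC hH hE' hG' hC' hH'
    rw [onLine_affinePt_dirLine _ _ hd] at hE' hG' hC' hH'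
    rw [affinePt_eq_mk, onLine_mk] at hE hG hC hH
    by_contra hne
    apply hk
    -- The difference of the two segments is parallel to k and, by the relation between offsets, to
    -- d. If it were nonzero, k would pass through the point at infinity.
    have hx : hvec (G - E - (C' - H)) 0 ∈ k := by
      have := k.sub_mem (k.sub_mem hG hE) (k.sub_mem hC hH)
      convert this using 1
      ext i; fin_cases i <;> simp [hvec]
    have him : ((G - E - (C' - H)) / d).im = 0 := by
      simp only [sub_div, add_div, Complex.sub_im, Complex.add_im] at *
      linarith
    obtain ⟨r, hr⟩ := im_eq_zero_iff.1 him
    rw [div_eq_iff hd] at hr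
    have hr0 : r ≠ 0 := by
      rintro rfl
      apply hne
      rw [← sub_eq_zero, hr]; simp
    rw [infinitePt, onLine_mk]
    have := k.smul_mem r⁻¹ hx
    rw [hr, smul_hvec] at this
    convert this using 2
    · push_cast
      have : (r : ℂ) ≠ 0 := by exact_mod_cast hr0
      field_simp
    · simp

end Isogonality

/-! ### The normal form of an isogonal cubic -/

section NormalForm

open MvPolynomial Projectivization ComplexConjugate

/-- The homogenisation of `η ↦ |η|² (Im (η + q / η) - k)`. -/
def frameForm (q : ℂ) (k : ℝ) (η : ℂ) (w : ℝ) : ℝ :=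
  Complex.normSq η * (η.im - k * w) + w ^ 2 * (q * conj η).im

lemma im_mul_conj_eq (q : ℂ) {η : ℂ} (hη : η ≠ 0) :
    (q * conj η).im = Complex.normSq η * (q / η).im := by
  have h : q * conj η = (Complex.normSq η : ℝ) * (q / η) := by
    rw [← Complex.mul_conj]; field_simp
  rw [h, Complex.im_ofReal_mul]

/-- An affine coordinate `η` on the plane with origin at the spiral center, in which the sums of
opposite vertices differ by `1`, and the equation of the isogonal cubic in it. -/
structure IsogonalFrame (F : MvPolynomial (Fin 3) ℝ) (Q : Quadrilateral) where
  P : ℂ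
  δ : ℂ
  q : ℂ
  k : ℝ
  c : ℝ
  α : ℂ
  β : ℂ
  γ : ℂ
  ε : ℂ
  δ_ne : δ ≠ 0
  c_ne : c ≠ 0
  hA : Q.A = P + δ * α
  hB : Q.B = P + δ * β
  hC : Q.C = P + δ * γ
  hD : Q.D = P + δ * ε
  αγ : α * γ = q
  βε : β * ε = q
  sum_eq : α + γ = β + ε + 1
  hk : (α + γ).im = k
  eval_eq : ∀ (η : ℂ) (w : ℝ), eval (hvec (w * P + δ * η) w) F = c * frameForm q k η w
  nondeg : ¬ (k = 0 ∧ q.im = 0)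

lemma frameForm_one (q : ℂ) (k : ℝ) {η : ℂ} (hη : η ≠ 0) :
    frameForm q k η 1 = Complex.normSq η * ((η + q / η).im - k) := by
  rw [frameForm, im_mul_conj_eq q hη, Complex.add_im]; ring

lemma frameForm_zero_left (q : ℂ) (k w : ℝ) : frameForm q k 0 w = 0 := by simp [frameForm]

lemma frameForm_smul (q : ℂ) (k : ℝ) (η : ℂ) (w t : ℝ) :
    frameForm q k (t * η) (t * w) = t ^ 3 * frameForm q k η w := by
  simp [frameForm, Complex.normSq_apply]; ring

lemma frameForm_eq_zero_of_mul_eq {q η η' : ℂ} {k : ℝ} (h : η * η' = q) (hs : (η + η').im = k) :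
    frameForm q k η 1 = 0 := by
  by_cases hη : η = 0
  · rw [hη, frameForm_zero_left]
  · rw [frameForm_one q k hη, ← h, mul_div_cancel_left₀ _ hη, hs, sub_self, mul_zero]

/-- The linear form `Re ((z - w P) / δ)`. -/
def frameRe (P δ : ℂ) : MvPolynomial (Fin 3) ℝ :=
  C (δ⁻¹).re * X 0 - C (δ⁻¹).im * X 1 - C (P * δ⁻¹).re * X 2

/-- The linear form `Im ((z - w P) / δ)`. -/
def frameIm (P δ : ℂ) : MvPolynomial (Fin 3) ℝ :=
  C (δ⁻¹).im * X 0 + C (δ⁻¹).re * X 1 - C (P * δ⁻¹).im * X 2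

/-- `frameForm` as a polynomial in the homogeneous coordinates of the plane. -/
def framePoly (P δ q : ℂ) (k : ℝ) : MvPolynomial (Fin 3) ℝ :=
  (frameRe P δ ^ 2 + frameIm P δ ^ 2) * (frameIm P δ - C k * X 2) +
    X 2 ^ 2 * (C q.im * frameRe P δ - C q.re * frameIm P δ)

lemma isHomogeneous_frameRe (P δ : ℂ) : (frameRe P δ).IsHomogeneous 1 :=
  ((isHomogeneous_C_mul_X _ _).sub (isHomogeneous_C_mul_X _ _)).sub (isHomogeneous_C_mul_X _ _)

lemma isHomogeneous_frameIm (P δ : ℂ) : (frameIm P δ).IsHomogeneous 1 :=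
  ((isHomogeneous_C_mul_X _ _).add (isHomogeneous_C_mul_X _ _)).sub (isHomogeneous_C_mul_X _ _)

lemma isHomogeneous_framePoly (P δ q : ℂ) (k : ℝ) : (framePoly P δ q k).IsHomogeneous 3 := by
  have hU := isHomogeneous_frameRe P δ
  have hV := isHomogeneous_frameIm P δ
  exact (((hU.pow 2).add (hV.pow 2)).mul (hV.sub (isHomogeneous_C_mul_X _ _))).add
    ((isHomogeneous_X_pow 2 2).mul ((hU.C_mul _).sub (hV.C_mul _)))

lemma eval_frameRe (P δ z : ℂ) (w : ℝ) :
    eval (hvec z w) (frameRe P δ) = ((z - w * P) / δ).re := by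
  simp [frameRe, hvec, div_eq_mul_inv, -Complex.inv_re, -Complex.inv_im]
  ring

lemma eval_frameIm (P δ z : ℂ) (w : ℝ) :
    eval (hvec z w) (frameIm P δ) = ((z - w * P) / δ).im := by
  simp [frameIm, hvec, div_eq_mul_inv, -Complex.inv_re, -Complex.inv_im]
  ring

lemma eval_framePoly (P δ q : ℂ) (k : ℝ) (z : ℂ) (w : ℝ) :
    eval (hvec z w) (framePoly P δ q k) = frameForm q k ((z - w * P) / δ) w := by
  have hX : eval (hvec z w) (X 2) = w := by simp [hvec]
  simp only [framePoly, frameForm, map_add, map_mul, map_sub, map_pow, eval_frameRe, eval_frameIm,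
    eval_C, hX, Complex.normSq_apply, Complex.mul_im, Complex.conj_re, Complex.conj_im]
  ring

/-! ### Excellent points as zeros of the normal form -/

variable {F : MvPolynomial (Fin 3) ℝ} {Q : Quadrilateral}

lemma excellent_affinePt {z : ℂ} (h : Q.Excellent (affinePt z)) :
    z = Q.A ∨ z = Q.B ∨ z = Q.C ∨ z = Q.D ∨
      ((Q.A - z) * (Q.C - z) / ((Q.B - z) * (Q.D - z))).im = 0 := by
  by_cases hv : z = Q.A ∨ z = Q.B ∨ z = Q.C ∨ z = Q.D
  · tauto
  · push Not at hv
    obtain ⟨hA, hB, hC, hD⟩ := hv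
    rcases h with h | h
    · exfalso
      simp only [Quadrilateral.IsVertex, affinePt_injective.eq_iff] at h
      tauto
    · rw [joinLine_affinePt, joinLine_affinePt, joinLine_affinePt, joinLine_affinePt,
        isogonal_affinePt_iff z (sub_ne_zero.2 hA.symm) (sub_ne_zero.2 hC.symm)
          (sub_ne_zero.2 hB.symm) (sub_ne_zero.2 hD.symm)] at h
      tauto

lemma excellent_infinitePt_iff {d : ℂ} (hd : d ≠ 0) :
    Q.Excellent (infinitePt d hd) ↔ ((Q.A + Q.C - Q.B - Q.D) / d).im = 0 := by
  have hv : ¬ Q.IsVertex (infinitePt d hd) := by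
    simp only [Quadrilateral.IsVertex, (affinePt_ne_infinitePt _ hd).symm, or_self, not_false_iff]
  rw [Quadrilateral.Excellent, joinLine_comm _ (affinePt Q.A), joinLine_comm _ (affinePt Q.B),
    joinLine_comm _ (affinePt Q.C), joinLine_comm _ (affinePt Q.D), joinLine_infinitePt,
    joinLine_infinitePt, joinLine_infinitePt, joinLine_infinitePt, isogonal_infinitePt_iff]
  simp [hv]

/-- Otherwise every point at infinity would be excellent and the cubic would contain the line at
infinity. -/
lemma sum_vertices_ne (hF : IsNondegenerateCubic F) (hQ : Q.HasIsogonalCubic F) :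
    Q.A + Q.C - Q.B - Q.D ≠ 0 := by
  intro h
  have : X 2 ∣ F := by
    refine X_two_dvd_of_eval_eq_zero fun x y => ?_
    by_cases hd : (⟨x, y⟩ : ℂ) = 0
    · have hx : x = 0 := congrArg Complex.re hd
      have hy : y = 0 := congrArg Complex.im hd
      have h0 := eval_cubicForm_smul hF.1 0 0
      have e : ![x, y, 0] = 0 := by ext i; fin_cases i <;> simp [hx, hy]
      rw [e]
      simpa using h0
    · have h1 := (hQ (infinitePt _ hd)).2 ((excellent_infinitePt_iff hd).2 (by rw [h]; simp))
      rwa [infinitePt, mk_mem_curve hF.1] at h1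
  exact not_dvd_of_isHomogeneous_one hF (isHomogeneous_X ℝ 2) this

/-- Equal products and sums differing by 1 make the numerator minus the denominator equal to -η. If
the quotient is real, so is the denominator divided by η, which is η + q/η - (β + ε). -/
lemma frameForm_eq_zero_of_div_im {q α β γ ε η : ℂ} (αγ : α * γ = q) (βε : β * ε = q)
    (hs : α + γ = β + ε + 1) (hβ : β ≠ η) (hε : ε ≠ η)
    (h : ((α - η) * (γ - η) / ((β - η) * (ε - η))).im = 0) :
    frameForm q (α + γ).im η 1 = 0 := by
  by_cases hη : η = 0
  · rw [hη, frameForm_zero_left]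
  have hM : (β - η) * (ε - η) ≠ 0 := mul_ne_zero (sub_ne_zero.2 hβ) (sub_ne_zero.2 hε)
  obtain ⟨r, hr⟩ := im_eq_zero_iff.1 h
  rw [div_eq_iff hM] at hr
  have h1 : η = (1 - r) * ((β - η) * (ε - η)) := by
    linear_combination (-1 : ℂ) * hr + αγ - βε - η * hs
  have hr1 : (1 - r : ℂ) ≠ 0 := by
    intro h0; rw [h0, zero_mul] at h1; exact hη h1
  have h2 : η + q / η - (β + ε) = ((1 - r)⁻¹ : ℝ) := by
    push_cast
    rw [← βε]
    field_simp
    linear_combination (-1 : ℂ) * h1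
  have h3 := congrArg Complex.im h2
  rw [Complex.sub_im, Complex.ofReal_im] at h3
  rw [frameForm_one q _ hη, hs, Complex.add_im (β + ε), Complex.one_im, add_zero, h3, mul_zero]

theorem nonempty_isogonalFrame (hF : IsNondegenerateCubic F) (hQ : Q.HasIsogonalCubic F) :
    Nonempty (IsogonalFrame F Q) := by
  have hδ := sum_vertices_ne hF hQ
  set δ := Q.A + Q.C - Q.B - Q.D with hδ'
  set P := (Q.A * Q.C - Q.B * Q.D) / δ with hP
  have hPδ : P * δ = Q.A * Q.C - Q.B * Q.D := div_mul_cancel₀ _ hδ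
  set α := (Q.A - P) / δ with hα
  set β := (Q.B - P) / δ with hβ
  set γ := (Q.C - P) / δ with hγ
  set ε := (Q.D - P) / δ with hε
  have hA : Q.A = P + δ * α := by rw [hα]; field_simp; ring
  have hB : Q.B = P + δ * β := by rw [hβ]; field_simp; ring
  have hC : Q.C = P + δ * γ := by rw [hγ]; field_simp; ring
  have hD : Q.D = P + δ * ε := by rw [hε]; field_simp; ring
  have hsum : α + γ = β + ε + 1 := by
    have : δ * (α + γ) = δ * (β + ε + 1) := by
      linear_combination hB + hD - hA - hC + hδ'
    exact mul_left_cancel₀ hδ this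
  have hprod : β * ε = α * γ := by
    have h2 : (Q.A - P) * (Q.C - P) = (Q.B - P) * (Q.D - P) := by
      linear_combination (-1 : ℂ) * hPδ + P * hδ'
    simp only [hα, hβ, hγ, hε]
    field_simp
    linear_combination (-1 : ℂ) * h2
  set q := α * γ with hq
  set k := (α + γ).im with hk
  have hzero : ∀ v, eval v F = 0 → eval v (framePoly P δ q k) = 0 := by
    intro v hv
    obtain ⟨z, w, rfl⟩ : ∃ z w, v = hvec z w := ⟨_, _, (hvec_surj v).symm⟩
    rw [eval_framePoly]
    by_cases hw : w = 0
    · subst hw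
      by_cases hz : z = 0
      · subst hz; simp [frameForm]
      · have h1 := (hQ (infinitePt z hz)).1 ((mk_mem_curve hF.1 _).2 hv)
        rw [excellent_infinitePt_iff] at h1
        have h2 := im_div_comm_eq_zero h1
        rw [← hδ'] at h2
        simp [frameForm, h2]
    · have hne : hvec z w ≠ 0 := by
        rw [← hvec_zero, Ne, hvec_inj]; tauto
      have h1 := (mk_mem_curve hF.1 hne).2 hv
      rw [mk_hvec_of_ne_zero hne hw] at h1
      have h2 := excellent_affinePt ((hQ _).1 h1)
      have hw' : (w : ℂ) ≠ 0 := by exact_mod_cast hw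
      set η := (z / w - P) / δ with hη
      have hz : z / w = P + δ * η := by rw [hη]; field_simp; ring
      have hsc : (z - w * P) / δ = w * η := by rw [hη]; field_simp
      have key : frameForm q k η 1 = 0 := by
        rw [hz] at h2
        -- Vertices belong to the locus by convention, so they are checked directly: opposite ones
        -- have product q and their sum has imaginary part k.
        by_cases e1 : P + δ * η = Q.A
        · have : η = α := by rw [hA] at e1; exact mul_left_cancel₀ hδ (add_left_cancel e1)
          rw [this]
          exact frameForm_eq_zero_of_mul_eq rfl rfl
        by_cases e2 : P + δ * η = Q.B
        · have : η = β := by rw [hB] at e2; exact mul_left_cancel₀ hδ (add_left_cancel e2)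
          rw [this]
          exact frameForm_eq_zero_of_mul_eq hprod (by rw [hk, hsum]; simp)
        by_cases e3 : P + δ * η = Q.C
        · have : η = γ := by rw [hC] at e3; exact mul_left_cancel₀ hδ (add_left_cancel e3)
          rw [this]
          exact frameForm_eq_zero_of_mul_eq (mul_comm _ _) (by rw [hk, add_comm])
        by_cases e4 : P + δ * η = Q.D
        · have : η = ε := by rw [hD] at e4; exact mul_left_cancel₀ hδ (add_left_cancel e4)
          rw [this]
          exact frameForm_eq_zero_of_mul_eq ((mul_comm _ _).trans hprod)
            (by rw [hk, hsum, add_comm ε]; simp)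
        have h3 : ((Q.A - (P + δ * η)) * (Q.C - (P + δ * η)) /
            ((Q.B - (P + δ * η)) * (Q.D - (P + δ * η)))).im = 0 := by tauto
        refine frameForm_eq_zero_of_div_im rfl hprod hsum ?_ ?_ ?_
        · intro h; exact e2 (by rw [← h, ← hB])
        · intro h; exact e4 (by rw [← h, ← hD])
        · rw [hA, hB, hC, hD] at h3
          have : ∀ x : ℂ, P + δ * x - (P + δ * η) = δ * (x - η) := fun x => by ring
          rw [this, this, this, this, mul_mul_mul_comm, mul_mul_mul_comm δ (β - η),
            mul_div_mul_left _ _ (mul_ne_zero hδ hδ)] at h3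
          exact h3
      have := frameForm_smul q k η 1 w
      rw [mul_one, key, mul_zero] at this
      rw [hsc, this]
  have hev : ∀ (η : ℂ) (w : ℝ), eval (hvec (w * P + δ * η) w) (framePoly P δ q k) =
      frameForm q k η w := by
    intro η w
    rw [eval_framePoly]
    congr 1
    field_simp
    ring
  have hG0 : framePoly P δ q k ≠ 0 := by
    intro h
    have := hev Complex.I 0
    rw [h] at this
    simp [frameForm] at this
  -- The curve meets infinity only in the direction δ, so it cannot contain both coordinate
  -- directions.
  have h01 : eval ![1, 0, 0] F ≠ 0 ∨ eval ![0, 1, 0] F ≠ 0 := by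
    by_contra! h
    have e1 : (![1, 0, 0] : Fin 3 → ℝ) = hvec 1 0 := by ext i; fin_cases i <;> simp [hvec]
    have e2 : (![0, 1, 0] : Fin 3 → ℝ) = hvec Complex.I 0 := by
      ext i; fin_cases i <;> simp [hvec]
    have h1 := (hQ (infinitePt 1 one_ne_zero)).1 ((mk_mem_curve hF.1 _).2 (by rw [← e1]; exact h.1))
    have h2 := (hQ (infinitePt Complex.I Complex.I_ne_zero)).1
      ((mk_mem_curve hF.1 _).2 (by rw [← e2]; exact h.2))
    rw [excellent_infinitePt_iff, ← hδ'] at h1 h2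
    apply hδ
    apply Complex.ext
    · simpa using h2
    · simpa using h1
  obtain ⟨c, hc, hFG⟩ := exists_eval_eq_mul_of_zeros hF (isHomogeneous_framePoly P δ q k) hG0 h01
    hzero
  refine ⟨⟨P, δ, q, k, c, α, β, γ, ε, hδ, hc, hA, hB, hC, hD, rfl, hprod, hsum, rfl,
    fun η w => by rw [hFG, hev], ?_⟩⟩
  -- For k = 0 and q real the form is divisible by Im η.
  rintro ⟨hk0, hq0⟩
  refine not_dvd_of_isHomogeneous_one hF (isHomogeneous_frameIm P δ)
    ⟨C c * (frameRe P δ ^ 2 + frameIm P δ ^ 2 - C q.re * X 2 ^ 2), ?_⟩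
  refine MvPolynomial.funext fun v => ?_
  rw [hFG]
  simp only [framePoly, hk0, hq0, map_add, map_mul, map_sub, map_pow, eval_C]
  ring

end NormalForm

/-! ### Singular points and third intersections on an isogonal cubic -/

section Frame

open MvPolynomial Projectivization ComplexConjugate

/-- The point `X` has homogeneous coordinates `v`. -/
def HasCoords (X : RP2) (v : Fin 3 → ℝ) : Prop := ∃ h : v ≠ 0, X = mk ℝ v h

variable {F : MvPolynomial (Fin 3) ℝ} {Q : Quadrilateral}

lemma HasCoords.mem_curve_iff {X : RP2} {v : Fin 3 → ℝ} (h : HasCoords X v)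
    (hF : F.IsHomogeneous 3) : X ∈ curve F ↔ eval v F = 0 := by
  obtain ⟨hv, rfl⟩ := h
  exact mk_mem_curve hF hv

theorem thirdIntersection_of_factor (hF : F.IsHomogeneous 3) {e f : Fin 3 → ℝ}
    (hef : LinearIndependent ℝ ![e, f]) {κ : ℝ} (hκ : κ ≠ 0) {x y z : ℝ × ℝ}
    (hg : ∀ p, eval (comb e f p) F = κ * detPair p x * detPair p y * detPair p z) {X Y Z₀ : RP2}
    (hX : HasCoords X (comb e f x)) (hY : HasCoords Y (comb e f y))
    (hZ : HasCoords Z₀ (comb e f z)) (hsX : ¬ IsSingularPt F X) (hsY : ¬ IsSingularPt F Y) :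
    Z₀ ∈ curve F ∧ ¬ IsSingularPt F Z₀ ∧ ∀ Z, IsThirdIntersection F X Y Z ↔ Z = Z₀ := by
  obtain ⟨hx, rfl⟩ := hX
  obtain ⟨hy, rfl⟩ := hY
  obtain ⟨hz, rfl⟩ := hZ
  refine ⟨(mk_mem_curve hF hz).2 ?_, not_isSingularPt_of_factor hF hef hκ hg hx hy hz hsX hsY,
    isThirdIntersection_iff_of_factor hF hef hκ hg hx hy hz hsX hsY⟩
  rw [hg, detPair_self, mul_zero]

lemma isThirdIntersection_of_singular_right {X Y : RP2} (hX : ¬ IsSingularPt F X)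
    (hY : IsSingularPt F Y) (Z : RP2) : IsThirdIntersection F X Y Z ↔ Z = Y := by
  simp [IsThirdIntersection, hX, hY]

/-- The derivative of `frameForm`. -/
def framePolar (q : ℂ) (k : ℝ) (η : ℂ) (w : ℝ) (η' : ℂ) (w' : ℝ) : ℝ :=
  2 * (η * conj η').re * (η.im - k * w) + Complex.normSq η * (η'.im - k * w') +
    2 * w * w' * (q * conj η).im + w ^ 2 * (q * conj η').im

namespace IsogonalFrame

variable (fr : IsogonalFrame F Q)

/-- The vector of `ℝ³` with coordinates `(η, w)` in the frame. -/
def vec (η : ℂ) (w : ℝ) : Fin 3 → ℝ := hvec (w * fr.P + fr.δ * η) w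

/-- The affine point with coordinate `η` in the frame. -/
def pt (η : ℂ) : RP2 := affinePt (fr.P + fr.δ * η)

/-- The point at infinity of the curve. -/
def inf : RP2 := infinitePt fr.δ fr.δ_ne

lemma smul_vec_add (a b : ℝ) (η η' : ℂ) (w w' : ℝ) :
    a • fr.vec η w + b • fr.vec η' w' = fr.vec (a * η + b * η') (a * w + b * w') := by
  simp only [vec, smul_hvec_add]
  congr 1
  push_cast; ring

lemma vec_surj (v : Fin 3 → ℝ) : ∃ η w, v = fr.vec η w := by
  have h := fr.δ_ne
  refine ⟨(⟨v 0, v 1⟩ - v 2 * fr.P) / fr.δ, v 2, ?_⟩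
  conv_lhs => rw [← hvec_surj v]
  rw [vec]
  congr 1
  field_simp
  ring

lemma vec_zero_right (η : ℂ) : fr.vec η 0 = hvec (fr.δ * η) 0 := by simp [vec]

lemma vec_one_right (η : ℂ) : fr.vec η 1 = hvec (fr.P + fr.δ * η) 1 := by simp [vec]

lemma vec_ne_zero {η : ℂ} {w : ℝ} (h : η ≠ 0 ∨ w ≠ 0) : fr.vec η w ≠ 0 := by
  rw [vec, ← hvec_zero, Ne, hvec_inj]
  rintro ⟨h1, rfl⟩
  simp [fr.δ_ne] at h1
  simp [h1] at h

lemma hasCoords_pt (η : ℂ) : HasCoords (fr.pt η) (fr.vec η 1) := by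
  rw [fr.vec_one_right]
  exact ⟨hvec_one_ne_zero _, rfl⟩

lemma hasCoords_inf : HasCoords fr.inf (fr.vec 1 0) := by
  rw [fr.vec_zero_right, mul_one]
  exact ⟨hvec_inf_ne_zero fr.δ_ne, rfl⟩

lemma eval_vec (η : ℂ) (w : ℝ) : eval (fr.vec η w) F = fr.c * frameForm fr.q fr.k η w :=
  fr.eval_eq η w

lemma pt_zero : fr.pt 0 = affinePt fr.P := by simp [pt]

lemma exists_pt (z : ℂ) : ∃ η, affinePt z = fr.pt η := by
  have := fr.δ_ne
  exact ⟨(z - fr.P) / fr.δ, by rw [pt]; congr 1; field_simp; ring⟩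

lemma pt_injective : Function.Injective fr.pt := fun η η' h => by
  have := affinePt_injective h
  exact mul_left_cancel₀ fr.δ_ne (add_left_cancel this)

lemma q_ne_zero : fr.q ≠ 0 := by
  intro h
  have h1 := fr.αγ
  have h2 := fr.βε
  rw [h, mul_eq_zero] at h1 h2
  rcases h1 with h1 | h1 <;> rcases h2 with h2 | h2
  · exact Q.ne_AB (by rw [fr.hA, fr.hB, h1, h2])
  · exact Q.ne_AD (by rw [fr.hA, fr.hD, h1, h2])
  · exact Q.ne_BC (by rw [fr.hB, fr.hC, h1, h2])
  · exact Q.ne_CD (by rw [fr.hC, fr.hD, h1, h2])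

lemma pt_mem_curve_iff (hF : F.IsHomogeneous 3) (η : ℂ) :
    fr.pt η ∈ curve F ↔ frameForm fr.q fr.k η 1 = 0 := by
  rw [(fr.hasCoords_pt η).mem_curve_iff hF, fr.eval_vec]
  simp [fr.c_ne]

lemma inf_mem_curve (hF : F.IsHomogeneous 3) : fr.inf ∈ curve F := by
  rw [fr.hasCoords_inf.mem_curve_iff hF, fr.eval_vec]
  simp [frameForm]

lemma mem_curve_atInfinity_iff (hF : F.IsHomogeneous 3) (Z : RP2) :
    (Z ∈ curve F ∧ AtInfinity Z) ↔ Z = fr.inf := by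
  constructor
  · rintro ⟨h1, h2⟩
    rcases point_cases Z with ⟨z, rfl⟩ | ⟨d, hd, rfl⟩
    · exact absurd h2 (not_atInfinity_affinePt z)
    · have hδ := fr.δ_ne
      rw [inf, infinitePt_eq_iff]
      have h3 : HasCoords (infinitePt d hd) (fr.vec (d / fr.δ) 0) := by
        rw [fr.vec_zero_right, mul_div_cancel₀ _ hδ]
        exact ⟨hvec_inf_ne_zero hd, rfl⟩
      rw [h3.mem_curve_iff hF, fr.eval_vec] at h1
      have h4 : d / fr.δ ≠ 0 := div_ne_zero hd hδ
      simpa [frameForm, fr.c_ne, hd, hδ] using h1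
  · rintro rfl
    exact ⟨fr.inf_mem_curve hF, atInfinity_infinitePt _⟩

lemma mem_curve_cases (hF : F.IsHomogeneous 3) {X : RP2} (hX : X ∈ curve F) :
    X = fr.inf ∨ ∃ η, X = fr.pt η ∧ frameForm fr.q fr.k η 1 = 0 := by
  rcases point_cases X with ⟨z, rfl⟩ | ⟨d, hd, rfl⟩
  · obtain ⟨η, h⟩ := fr.exists_pt z
    rw [h] at hX ⊢
    exact Or.inr ⟨η, rfl, (fr.pt_mem_curve_iff hF η).1 hX⟩
  · exact Or.inl ((fr.mem_curve_atInfinity_iff hF _).1 ⟨hX, atInfinity_infinitePt hd⟩)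

lemma polarForm_vec (hF : F.IsHomogeneous 3) (η : ℂ) (w : ℝ) (η' : ℂ) (w' : ℝ) :
    polarForm F (fr.vec η w) (fr.vec η' w') = fr.c * framePolar fr.q fr.k η w η' w' := by
  have h1 := eval_cubicForm_comb hF (fr.vec η w) (fr.vec η' w') 1 1
  have h2 := eval_cubicForm_comb hF (fr.vec η w) (fr.vec η' w') 1 (-1)
  rw [smul_vec_add, eval_vec, eval_vec, eval_vec] at h1 h2
  simp only [frameForm, framePolar, Complex.normSq_apply, Complex.mul_im, Complex.mul_re,
    Complex.conj_re, Complex.conj_im, Complex.add_re, Complex.add_im, Complex.ofReal_re,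
    Complex.ofReal_im] at *
  linear_combination (-1 / 2) * h1 + (1 / 2) * h2

lemma isSingularPt_iff (hF : F.IsHomogeneous 3) {X : RP2} {η : ℂ} {w : ℝ}
    (h : HasCoords X (fr.vec η w)) :
    IsSingularPt F X ↔ ∀ η' w', framePolar fr.q fr.k η w η' w' = 0 := by
  obtain ⟨hv, rfl⟩ := h
  rw [isSingularPt_mk hF]
  constructor
  · intro h η' w'
    have := h (fr.vec η' w')
    rw [fr.polarForm_vec hF] at this
    simpa [fr.c_ne] using this
  · intro h y
    obtain ⟨η', w', rfl⟩ := fr.vec_surj y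
    rw [fr.polarForm_vec hF, h, mul_zero]

lemma not_isSingularPt_inf (hF : F.IsHomogeneous 3) : ¬ IsSingularPt F fr.inf := by
  rw [fr.isSingularPt_iff hF fr.hasCoords_inf]
  intro h
  have := h Complex.I 0
  simp [framePolar] at this

lemma not_isSingularPt_center (hF : F.IsHomogeneous 3) : ¬ IsSingularPt F (fr.pt 0) := by
  rw [fr.isSingularPt_iff hF (fr.hasCoords_pt 0)]
  intro h
  have := h (Complex.I * fr.q) 0
  have hq := fr.q_ne_zero
  simp [framePolar] at this
  rw [Ne, ← Complex.normSq_eq_zero, Complex.normSq_apply] at hq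
  apply hq
  linarith

/-- Away from the origin the singular points are the critical points of η + q/η, that is, the fixed
points of η ↦ q/η. -/
lemma isSingularPt_pt_iff (hF : F.IsHomogeneous 3) {η : ℂ} (hη : frameForm fr.q fr.k η 1 = 0) :
    IsSingularPt F (fr.pt η) ↔ η ^ 2 = fr.q := by
  rw [fr.isSingularPt_iff hF (fr.hasCoords_pt η)]
  have hq := fr.q_ne_zero
  simp only [frameForm, framePolar, Complex.normSq_apply, Complex.mul_im, Complex.mul_re,
    Complex.conj_re, Complex.conj_im] at *
  constructor
  · intro h
    have h1 := h 1 0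
    have h2 := h Complex.I 0
    have h3 := h 0 1
    simp only [Complex.one_re, Complex.one_im, Complex.I_re, Complex.I_im, Complex.zero_re,
      Complex.zero_im] at h1 h2 h3
    -- Twice the form minus its derivative in w eliminates q.
    have h4 : (η.re ^ 2 + η.im ^ 2) * (2 * η.im - fr.k) = 0 := by
      linear_combination 2 * hη - h3
    rcases mul_eq_zero.1 h4 with h5 | h5
    · exfalso
      have hu : η.re = 0 := by nlinarith [sq_nonneg η.re, sq_nonneg η.im]
      have hv : η.im = 0 := by nlinarith [sq_nonneg η.re, sq_nonneg η.im]
      rw [hu, hv] at h1 h2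
      exact hq (Complex.ext (by simp; linarith) (by simp; linarith))
    · have hk : fr.k = 2 * η.im := by linarith
      rw [hk] at h1 h2
      apply Complex.ext
      · rw [pow_two, Complex.mul_re]; linarith
      · rw [pow_two, Complex.mul_im]; linarith
  · intro h η' w'
    have ha : fr.q.re = η.re * η.re - η.im * η.im := by rw [← h, pow_two, Complex.mul_re]
    have hb : fr.q.im = η.re * η.im + η.im * η.re := by rw [← h, pow_two, Complex.mul_im]
    have hη0 : η.re ^ 2 + η.im ^ 2 ≠ 0 := by
      intro h0
      have hu : η.re = 0 := by nlinarith [sq_nonneg η.re, sq_nonneg η.im]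
      have hv : η.im = 0 := by nlinarith [sq_nonneg η.re, sq_nonneg η.im]
      exact hq (Complex.ext (by simp [ha, hu, hv]) (by simp [hb, hu, hv]))
    have hk : fr.k = 2 * η.im := by
      rw [ha, hb] at hη
      have h4 : (η.re ^ 2 + η.im ^ 2) * (2 * η.im - fr.k) = 0 := by linear_combination hη
      have := (mul_eq_zero.1 h4).resolve_left hη0
      linarith
    rw [ha, hb, hk]
    ring

lemma linearIndependent_vec (ζ : ℂ) {η : ℂ} (hη : η ≠ 0) :
    LinearIndependent ℝ ![fr.vec ζ 1, fr.vec η 0] := by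
  rw [fr.vec_one_right, fr.vec_zero_right]
  exact linearIndependent_dirLine _ (mul_ne_zero fr.δ_ne hη)

lemma comb_vec (ζ η : ℂ) (p : ℝ × ℝ) :
    comb (fr.vec ζ 1) (fr.vec η 0) p = fr.vec (p.1 * ζ + p.2 * η) p.1 := by
  rw [comb, smul_vec_add]; simp

/-- The relation between the points of the curve that the involution `η ↦ q / η` gives. -/
def Conj (X W : RP2) : Prop :=
  (∃ η, η ≠ 0 ∧ frameForm fr.q fr.k η 1 = 0 ∧ X = fr.pt η ∧ W = fr.pt (fr.q / η)) ∨
    (X = fr.pt 0 ∧ W = fr.inf) ∨ (X = fr.inf ∧ W = fr.pt 0)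

/-- The origin, the point at infinity and Y all lie on Im η = 0, so the second intersection on this
same line returns the origin. -/
lemma exists_thirdIntersections_inf (hF : F.IsHomogeneous 3) :
    ∃ Y ∈ curve F, (∀ Z, IsThirdIntersection F (fr.pt 0) fr.inf Z ↔ Z = Y) ∧
      ∀ Z, IsThirdIntersection F fr.inf Y Z ↔ Z = fr.pt 0 := by
  have hc := fr.c_ne
  have hne : (fr.q.im : ℂ) ≠ 0 ∨ fr.k ≠ 0 := by
    have := fr.nondeg
    rw [Complex.ofReal_ne_zero]
    tauto
  obtain ⟨hY1, hY2, hY3⟩ := thirdIntersection_of_factor hF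
    (fr.linearIndependent_vec 0 one_ne_zero) (κ := -fr.c) (x := (1, 0)) (y := (0, 1))
    (z := (fr.k, fr.q.im)) (neg_ne_zero.2 hc) (fun p => by
      rw [comb_vec, eval_vec]
      simp [frameForm, detPair, Complex.normSq_apply]
      ring) (X := fr.pt 0) (Y := fr.inf) (Z₀ := Projectivization.mk ℝ _ (fr.vec_ne_zero hne))
    (by rw [comb_vec]; simpa using fr.hasCoords_pt 0)
    (by rw [comb_vec]; simpa using fr.hasCoords_inf)
    (by rw [comb_vec]; exact ⟨by simpa using fr.vec_ne_zero hne, by simp⟩)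
    (fr.not_isSingularPt_center hF) (fr.not_isSingularPt_inf hF)
  refine ⟨_, hY1, hY3, ?_⟩
  exact (thirdIntersection_of_factor hF
    (fr.linearIndependent_vec 0 one_ne_zero) (κ := -fr.c) (x := (0, 1)) (y := (fr.k, fr.q.im))
    (z := (1, 0)) (neg_ne_zero.2 hc) (fun p => by
      rw [comb_vec, eval_vec]
      simp [frameForm, detPair, Complex.normSq_apply]
      ring)
    (by rw [comb_vec]; simpa using fr.hasCoords_inf)
    (by rw [comb_vec]; exact ⟨by simpa using fr.vec_ne_zero hne, by simp⟩)
    (by rw [comb_vec]; simpa using fr.hasCoords_pt 0)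
    (fr.not_isSingularPt_inf hF) hY2).2.2

/-- The tangent at the origin has direction q and meets the curve again on the asymptote Im η = k,
which is the tangent at the point at infinity. Infinity is therefore a double root there. -/
lemma exists_thirdIntersections_center (hF : F.IsHomogeneous 3) :
    ∃ Y ∈ curve F, (∀ Z, IsThirdIntersection F (fr.pt 0) (fr.pt 0) Z ↔ Z = Y) ∧
      ∀ Z, IsThirdIntersection F fr.inf Y Z ↔ Z = fr.inf := by
  have hc := fr.c_ne
  have hq := fr.q_ne_zero
  have hne : (fr.k : ℂ) * fr.q ≠ 0 ∨ fr.q.im ≠ 0 := by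
    have := fr.nondeg
    rw [mul_ne_zero_iff, Complex.ofReal_ne_zero]
    tauto
  obtain ⟨hY1, hY2, hY3⟩ := thirdIntersection_of_factor hF
    (fr.linearIndependent_vec 0 hq) (κ := -(fr.c * Complex.normSq fr.q)) (x := (1, 0)) (y := (1, 0))
    (z := (fr.q.im, fr.k)) (neg_ne_zero.2 (mul_ne_zero hc (by simpa using hq))) (fun p => by
      rw [comb_vec, eval_vec]
      simp [frameForm, detPair, Complex.normSq_apply]
      ring) (X := fr.pt 0) (Y := fr.pt 0) (Z₀ := Projectivization.mk ℝ _ (fr.vec_ne_zero hne))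
    (by rw [comb_vec]; simpa using fr.hasCoords_pt 0)
    (by rw [comb_vec]; simpa using fr.hasCoords_pt 0)
    (by rw [comb_vec]; exact ⟨by simpa using fr.vec_ne_zero hne, by simp⟩)
    (fr.not_isSingularPt_center hF) (fr.not_isSingularPt_center hF)
  refine ⟨_, hY1, hY3, ?_⟩
  have hY : (fr.q.im : ℂ) * (Complex.I * fr.k) + ((fr.k * fr.q.re : ℝ) : ℂ) * 1 =
      fr.k * fr.q := by
    apply Complex.ext <;> simp <;> ring
  exact (thirdIntersection_of_factor hF
    (fr.linearIndependent_vec (Complex.I * fr.k) one_ne_zero) (κ := -fr.c) (x := (0, 1))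
    (y := (fr.q.im, fr.k * fr.q.re)) (z := (0, 1)) (neg_ne_zero.2 hc) (fun p => by
      rw [comb_vec, eval_vec]
      simp [frameForm, detPair, Complex.normSq_apply]
      ring)
    (by rw [comb_vec]; simpa using fr.hasCoords_inf)
    (by rw [comb_vec, hY]; exact ⟨fr.vec_ne_zero hne, rfl⟩)
    (by rw [comb_vec]; simpa using fr.hasCoords_inf)
    (fr.not_isSingularPt_inf hF) hY2).2.2

/-- With ω = q/η and k = Im η + Im ω, the third root on the line through 0 and η is Y = (Im ω · η :
Im η). It lies on the line of height Im ω, whose intersections with the curve are infinity, Y and ω.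
-/
lemma exists_thirdIntersections_pt (hF : F.IsHomogeneous 3) {η : ℂ} (hη0 : η ≠ 0)
    (hη : frameForm fr.q fr.k η 1 = 0) (hs : ¬ IsSingularPt F (fr.pt η)) :
    ∃ Y ∈ curve F, (∀ Z, IsThirdIntersection F (fr.pt 0) (fr.pt η) Z ↔ Z = Y) ∧
      ∀ Z, IsThirdIntersection F fr.inf Y Z ↔ Z = fr.pt (fr.q / η) := by
  have hc := fr.c_ne
  have hn : Complex.normSq η ≠ 0 := by simpa using hη0
  obtain ⟨ω, hω⟩ : ∃ ω, fr.q / η = ω := ⟨_, rfl⟩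
  have hq : fr.q = ω * η := by rw [← hω]; field_simp
  have hk : fr.k = η.im + ω.im := by
    rw [frameForm_one _ _ hη0, hω, mul_eq_zero, Complex.add_im] at hη
    linarith [hη.resolve_left hn]
  rw [hω]
  -- If Im η and Im ω both vanished, k would be 0 and q real, contrary to `nondeg`.
  have hne : (ω.im : ℂ) * η ≠ 0 ∨ η.im ≠ 0 := by
    by_contra! h
    obtain ⟨h1, h2⟩ := h
    have h3 : ω.im = 0 := by simpa [hη0] using h1
    apply fr.nondeg
    rw [hk, hq, Complex.mul_im, h2, h3]
    simp
  obtain ⟨hY1, hY2, hY3⟩ := thirdIntersection_of_factor hF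
    (fr.linearIndependent_vec 0 hη0) (κ := -(fr.c * Complex.normSq η)) (x := (1, 0)) (y := (1, 1))
    (z := (η.im, ω.im)) (neg_ne_zero.2 (mul_ne_zero hc hn)) (fun p => by
      rw [comb_vec, eval_vec, hq, hk]
      simp [frameForm, detPair, Complex.normSq_apply]
      ring) (X := fr.pt 0) (Y := fr.pt η) (Z₀ := Projectivization.mk ℝ _ (fr.vec_ne_zero hne))
    (by rw [comb_vec]; simpa using fr.hasCoords_pt 0)
    (by rw [comb_vec]; simpa using fr.hasCoords_pt η)
    (by rw [comb_vec]; exact ⟨by simpa using fr.vec_ne_zero hne, by simp⟩)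
    (fr.not_isSingularPt_center hF) hs
  refine ⟨_, hY1, hY3, ?_⟩
  have hY : (η.im : ℂ) * (Complex.I * ω.im) + ((ω.im * η.re : ℝ) : ℂ) * 1 = ω.im * η := by
    apply Complex.ext <;> simp <;> ring
  have hW : ((1 : ℝ) : ℂ) * (Complex.I * ω.im) + (ω.re : ℂ) * 1 = ω := by
    apply Complex.ext <;> simp
  exact (thirdIntersection_of_factor hF
    (fr.linearIndependent_vec (Complex.I * ω.im) one_ne_zero) (κ := -fr.c) (x := (0, 1))
    (y := (η.im, ω.im * η.re)) (z := (1, ω.re)) (neg_ne_zero.2 hc) (fun p => by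
      rw [comb_vec, eval_vec, hq, hk]
      simp [frameForm, detPair, Complex.normSq_apply]
      ring)
    (by rw [comb_vec]; simpa using fr.hasCoords_inf)
    (by rw [comb_vec, hY]; exact ⟨fr.vec_ne_zero hne, rfl⟩)
    (by rw [comb_vec, hW]; exact fr.hasCoords_pt ω)
    (fr.not_isSingularPt_inf hF) hY2).2.2

lemma frameForm_conj {q η : ℂ} {k : ℝ} (hq : q ≠ 0) (hη0 : η ≠ 0) (hη : frameForm q k η 1 = 0) :
    frameForm q k (q / η) 1 = 0 := by
  have hn : Complex.normSq η ≠ 0 := by simpa using hη0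
  have h : q / (q / η) = η := by field_simp
  rw [frameForm_one _ _ hη0] at hη
  rw [frameForm_one _ _ (div_ne_zero hq hη0), h, add_comm, (mul_eq_zero.1 hη).resolve_left hn,
    mul_zero]

theorem exists_thirdIntersections (hF : F.IsHomogeneous 3) {X : RP2} (hX : X ∈ curve F) :
    ∃ Y ∈ curve F, ∃ W ∈ curve F, (∀ Z, IsThirdIntersection F (fr.pt 0) X Z ↔ Z = Y) ∧
      (∀ Z, IsThirdIntersection F fr.inf Y Z ↔ Z = W) ∧ fr.Conj X W := by
  have hP : fr.pt 0 ∈ curve F := (fr.pt_mem_curve_iff hF 0).2 (frameForm_zero_left _ _ _)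
  rcases fr.mem_curve_cases hF hX with rfl | ⟨η, rfl, hη⟩
  · obtain ⟨Y, hY, h1, h2⟩ := fr.exists_thirdIntersections_inf hF
    exact ⟨Y, hY, fr.pt 0, hP, h1, h2, Or.inr (Or.inr ⟨rfl, rfl⟩)⟩
  by_cases hη0 : η = 0
  · subst hη0
    obtain ⟨Y, hY, h1, h2⟩ := fr.exists_thirdIntersections_center hF
    exact ⟨Y, hY, fr.inf, fr.inf_mem_curve hF, h1, h2, Or.inr (Or.inl ⟨rfl, rfl⟩)⟩
  by_cases hs : IsSingularPt F (fr.pt η)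
  -- By convention both third intersections are the singular point itself, which η ↦ q/η fixes
  -- because η² = q.
  · refine ⟨fr.pt η, hX, fr.pt η, hX,
      isThirdIntersection_of_singular_right (fr.not_isSingularPt_center hF) hs,
      isThirdIntersection_of_singular_right (fr.not_isSingularPt_inf hF) hs,
      Or.inl ⟨η, hη0, hη, rfl, ?_⟩⟩
    rw [← (fr.isSingularPt_pt_iff hF hη).1 hs]
    congr 1
    field_simp
  · obtain ⟨Y, hY, h1, h2⟩ := fr.exists_thirdIntersections_pt hF hη0 hη hs
    exact ⟨Y, hY, fr.pt (fr.q / η),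
      (fr.pt_mem_curve_iff hF _).2 (frameForm_conj fr.q_ne_zero hη0 hη), h1, h2,
      Or.inl ⟨η, hη0, hη, rfl, rfl⟩⟩

end IsogonalFrame

end Frame

/-! ### Isogonal conjugates -/

section Conjugates

open MvPolynomial Projectivization ComplexConjugate

variable {F : MvPolynomial (Fin 3) ℝ} {Q : Quadrilateral}

lemma dirLine_eq_iff (z : ℂ) {d d' : ℂ} (hd : d ≠ 0) (hd' : d' ≠ 0) :
    dirLine z d = dirLine z d' ↔ (d / d').im = 0 := by
  constructor
  · intro h
    have h1 := congrArg lineDirection h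
    rw [lineDirection_dirLine z hd, lineDirection_dirLine z hd'] at h1
    rw [← mem_span_iff_im hd', ← h1]
    exact Submodule.mem_span_singleton_self d
  · intro h
    refine Submodule.eq_of_le_of_finrank_eq ?_ (by rw [finrank_dirLine z hd, finrank_dirLine z hd'])
    rw [dirLine, Submodule.span_le]
    rintro v (rfl | rfl)
    · exact (hvec_mem_dirLine hd' _ _).2 (by simp)
    · exact (hvec_mem_dirLine hd' _ _).2 (by simpa using h)

lemma onLine_left (X Y : RP2) : OnLine X (joinLine X Y) := le_sup_left

lemma onLine_right (X Y : RP2) : OnLine Y (joinLine X Y) := le_sup_right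

lemma finrank_joinLine {X Y : RP2} (h : X ≠ Y) : Module.finrank ℝ (joinLine X Y) = 2 := by
  have hi := (linearIndependent_pair_iff_ne (K := ℝ) (D := X) (D' := Y)).2 h
  rw [joinLine, submodule_eq, submodule_eq, ← Submodule.span_insert]
  exact finrank_span_pair hi

lemma joinLine_eq_of_onLine {X Y : RP2} (h : X ≠ Y) {l : ProjLine}
    (hl : Module.finrank ℝ l = 2) (hX : OnLine X l) (hY : OnLine Y l) : joinLine X Y = l :=
  Submodule.eq_of_le_of_finrank_eq (sup_le hX hY) (by rw [finrank_joinLine h, hl])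

/-- When V is Z or W it lies on their join trivially, so tangents never enter; otherwise the common
line is the join. -/
lemma onLine_of_lineXY_eq {V Z W : RP2} (hZW : Z ≠ W) (h : lineXY F V Z = lineXY F V W) :
    OnLine V (joinLine Z W) := by
  by_cases h1 : V = Z
  · exact h1 ▸ onLine_left _ _
  by_cases h2 : V = W
  · exact h2 ▸ onLine_right _ _
  rw [lineXY, lineXY, if_neg h1, if_neg h2] at h
  rw [joinLine_eq_of_onLine hZW (finrank_joinLine h1) (onLine_right _ _) (h ▸ onLine_right _ _)]
  exact onLine_left _ _

namespace IsogonalFrame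

variable (fr : IsogonalFrame F Q)

/-- `v` is the coordinate of a regular point of the curve other than the spiral center. -/
structure IsRegular (v : ℂ) : Prop where
  ne_zero : v ≠ 0
  mem : frameForm fr.q fr.k v 1 = 0
  sq_ne : v ^ 2 ≠ fr.q

/-- The line through the point `v` in the direction `d`, in the frame. -/
def line (v d : ℂ) : ProjLine := dirLine (fr.P + fr.δ * v) (fr.δ * d)

variable {fr}

lemma line_eq_iff (v : ℂ) {d d' : ℂ} (hd : d ≠ 0) (hd' : d' ≠ 0) :
    fr.line v d = fr.line v d' ↔ (d / d').im = 0 := by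
  rw [line, line, dirLine_eq_iff _ (mul_ne_zero fr.δ_ne hd) (mul_ne_zero fr.δ_ne hd'),
    mul_div_mul_left _ _ fr.δ_ne]

lemma joinLine_pt (v x : ℂ) : joinLine (fr.pt v) (fr.pt x) = fr.line v (x - v) := by
  rw [pt, pt, joinLine_affinePt, line]
  congr 1
  ring

lemma lineXY_pt {v x : ℂ} (h : x ≠ v) : lineXY F (fr.pt v) (fr.pt x) = fr.line v (x - v) := by
  rw [lineXY, if_neg (fun h' => h (fr.pt_injective h').symm), joinLine_pt]

lemma lineXY_inf (v : ℂ) : lineXY F (fr.pt v) fr.inf = fr.line v 1 := by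
  rw [lineXY, pt, inf, if_neg (affinePt_ne_infinitePt _ _), joinLine_infinitePt, line, mul_one]

lemma IsRegular.tangent_ne {v : ℂ} (hv : fr.IsRegular v) : v ^ 2 * conj (v ^ 2 - fr.q) ≠ 0 :=
  mul_ne_zero (pow_ne_zero 2 hv.ne_zero) (by
    rw [Ne, map_eq_zero, sub_eq_zero]; exact hv.sq_ne)

/-- The derivative of η + q/η at v is (v² - q)/v². The tangent direction is the one it makes real, a
real multiple of v²/(v² - q). -/
lemma IsRegular.lineXY_self (hF : F.IsHomogeneous 3) {v : ℂ} (hv : fr.IsRegular v) :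
    lineXY F (fr.pt v) (fr.pt v) = fr.line v (v ^ 2 * conj (v ^ 2 - fr.q)) := by
  have hs : ¬ IsSingularPt F (fr.pt v) := by
    rw [fr.isSingularPt_pt_iff hF hv.mem]; exact hv.sq_ne
  have hmem := hv.mem
  have h0 : eval (fr.vec v 1) F = 0 := by rw [fr.eval_vec, hmem, mul_zero]
  obtain ⟨hne, hpt⟩ := fr.hasCoords_pt v
  rw [lineXY, if_pos rfl]
  rw [hpt] at hs ⊢
  rw [tangentAt_eq_span hF (fr.linearIndependent_vec v hv.tangent_ne) hne hs, line, dirLine,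
    vec_one_right, vec_zero_right]
  · rw [polarForm_self hF, h0, mul_zero]
  · rw [fr.polarForm_vec hF]
    have hn : v.re ^ 2 + v.im ^ 2 ≠ 0 := by
      intro h
      apply hv.ne_zero
      rw [← Complex.normSq_eq_zero, Complex.normSq_apply]; linarith
    have : framePolar fr.q fr.k v 1 (v ^ 2 * conj (v ^ 2 - fr.q)) 0 = 0 := by
      simp only [frameForm, framePolar, Complex.normSq_apply, Complex.mul_im, Complex.mul_re,
        Complex.conj_re, Complex.conj_im, Complex.sub_re, Complex.sub_im, pow_two v,
        map_mul, map_sub, Complex.conj_conj] at *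
      generalize v.re = a at *
      generalize v.im = b at *
      generalize fr.q.re = x at *
      generalize fr.q.im = y at *
      refine (mul_eq_zero.1 ?_).resolve_left hn
      -- The multiplier of the curve equation is 2 Re(v̄ d), d being the tangent direction; it
      -- eliminates k from |v|² times the polar.
      linear_combination (2 * (a * ((a ^ 2 - b ^ 2) * (a ^ 2 - b ^ 2 - x) +
        2 * a * b * (2 * a * b - y)) + b * (2 * a * b * (a ^ 2 - b ^ 2 - x) -
        (a ^ 2 - b ^ 2) * (2 * a * b - y)))) * hmem
    rw [this, mul_zero]

lemma IsRegular.exists_line (hF : F.IsHomogeneous 3) {v : ℂ} (hv : fr.IsRegular v) (X : RP2) :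
    ∃ d, d ≠ 0 ∧ lineXY F (fr.pt v) X = fr.line v d := by
  rcases point_cases X with ⟨z, rfl⟩ | ⟨d, hd, rfl⟩
  · obtain ⟨x, hx⟩ := fr.exists_pt z
    rw [hx]
    by_cases h : x = v
    · subst h
      exact ⟨_, hv.tangent_ne, hv.lineXY_self hF⟩
    · exact ⟨_, sub_ne_zero.2 h, lineXY_pt h⟩
  · refine ⟨d / fr.δ, div_ne_zero hd fr.δ_ne, ?_⟩
    rw [lineXY, pt, if_neg (affinePt_ne_infinitePt _ _), joinLine_infinitePt, line,
      mul_div_cancel₀ _ fr.δ_ne]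

variable (fr) in
/-- The lines from `v` to `X` and `Z` are isogonal with respect to the sides at `v`. -/
def IsogonalAt (v : ℂ) (X Z : RP2) : Prop :=
  ∃ d d', d ≠ 0 ∧ d' ≠ 0 ∧ lineXY F (fr.pt v) X = fr.line v d ∧
    lineXY F (fr.pt v) Z = fr.line v d' ∧ (d * d' / v).im = 0

lemma isogonal_line_iff {v d d' x y : ℂ} (hd : d ≠ 0) (hd' : d' ≠ 0)
    (hx : x - v ≠ 0) (hy : y - v ≠ 0) (hxy : (x - v) * (y - v) = v ∨ (x - v) * (y - v) = -v) :
    Isogonal (fr.pt v) (fr.line v d) (fr.line v d') (joinLine (fr.pt v) (fr.pt x))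
      (joinLine (fr.pt v) (fr.pt y)) ↔ (d * d' / v).im = 0 := by
  have h := fr.δ_ne
  rw [joinLine_pt, joinLine_pt, pt, line, line, line, line,
    isogonal_affinePt_iff _ (mul_ne_zero h hd) (mul_ne_zero h hd') (mul_ne_zero h hx)
      (mul_ne_zero h hy), mul_mul_mul_comm, mul_mul_mul_comm fr.δ (x - v),
    mul_div_mul_left _ _ (mul_ne_zero h h)]
  rcases hxy with h | h
  · rw [h]
  · rw [h, div_neg, Complex.neg_im, neg_eq_zero]

lemma IsRegular.isogonal_iff (hF : F.IsHomogeneous 3) {v x y : ℂ} (hv : fr.IsRegular v)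
    (hxy : (x - v) * (y - v) = v ∨ (x - v) * (y - v) = -v) (X Z : RP2) :
    Isogonal (fr.pt v) (lineXY F (fr.pt v) X) (lineXY F (fr.pt v) Z)
      (joinLine (fr.pt v) (fr.pt x)) (joinLine (fr.pt v) (fr.pt y)) ↔ fr.IsogonalAt v X Z := by
  have hne : (x - v) * (y - v) ≠ 0 := by
    rcases hxy with h | h <;> rw [h]
    · exact hv.ne_zero
    · exact neg_ne_zero.2 hv.ne_zero
  have hx := left_ne_zero_of_mul hne
  have hy := right_ne_zero_of_mul hne
  constructor
  · intro h
    obtain ⟨d, hd, h1⟩ := hv.exists_line hF X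
    obtain ⟨d', hd', h2⟩ := hv.exists_line hF Z
    rw [h1, h2, isogonal_line_iff hd hd' hx hy hxy] at h
    exact ⟨d, d', hd, hd', h1, h2, h⟩
  · rintro ⟨d, d', hd, hd', h1, h2, h⟩
    rw [h1, h2, isogonal_line_iff hd hd' hx hy hxy]
    exact h

variable (fr) in
lemma isRegular_of_vertices {x y : ℂ} (hxy : x * y = fr.q) (hk : (x + y).im = fr.k)
    (hne : x ≠ y) : fr.IsRegular x := by
  have h := fr.q_ne_zero
  rw [← hxy] at h
  have hx := left_ne_zero_of_mul h
  refine ⟨hx, frameForm_eq_zero_of_mul_eq hxy hk, ?_⟩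
  rw [← hxy, pow_two]
  exact fun h' => hne (mul_left_cancel₀ hx h')

variable (fr) in
lemma α_ne_γ : fr.α ≠ fr.γ := fun h => Q.ne_AC (by rw [fr.hA, fr.hC, h])

variable (fr) in
lemma β_ne_ε : fr.β ≠ fr.ε := fun h => Q.ne_BD (by rw [fr.hB, fr.hD, h])

variable (fr) in
lemma im_add_βε : (fr.β + fr.ε).im = fr.k := by rw [← fr.hk, fr.sum_eq]; simp

variable (fr) in
lemma isRegular_α : fr.IsRegular fr.α := fr.isRegular_of_vertices fr.αγ fr.hk fr.α_ne_γ

variable (fr) in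
lemma isRegular_γ : fr.IsRegular fr.γ := fr.isRegular_of_vertices ((mul_comm _ _).trans fr.αγ)
  (by rw [add_comm]; exact fr.hk) fr.α_ne_γ.symm

variable (fr) in
lemma isRegular_β : fr.IsRegular fr.β := fr.isRegular_of_vertices fr.βε fr.im_add_βε fr.β_ne_ε

variable (fr) in
lemma isRegular_ε : fr.IsRegular fr.ε := fr.isRegular_of_vertices ((mul_comm _ _).trans fr.βε)
  (by rw [add_comm]; exact fr.im_add_βε) fr.β_ne_ε.symm

variable (fr) in
lemma isogonalConjugates_iff (hF : F.IsHomogeneous 3) (X Z : RP2) :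
    Q.IsogonalConjugates F X Z ↔ fr.IsogonalAt fr.α X Z ∧ fr.IsogonalAt fr.β X Z ∧
      fr.IsogonalAt fr.γ X Z ∧ fr.IsogonalAt fr.ε X Z := by
  have h1 := fr.αγ
  have h2 := fr.βε
  have h3 := fr.sum_eq
  rw [Quadrilateral.IsogonalConjugates, fr.hA, fr.hB, fr.hC, fr.hD]
  refine and_congr (fr.isRegular_α.isogonal_iff hF (Or.inl ?_) X Z)
    (and_congr (fr.isRegular_β.isogonal_iff hF (Or.inr ?_) X Z)
      (and_congr (fr.isRegular_γ.isogonal_iff hF (Or.inl ?_) X Z)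
        (fr.isRegular_ε.isogonal_iff hF (Or.inr ?_) X Z)))
  -- For instance (β - α)(ε - α) = q - α(α + γ - 1) + α² = α; at β and ε the 1 enters with the other
  -- sign.
  · linear_combination h2 - h1 + fr.α * h3
  · linear_combination h1 - h2 - fr.β * h3
  · linear_combination h2 - h1 + fr.γ * h3
  · linear_combination h1 - h2 - fr.ε * h3

lemma IsRegular.conj_ne {v : ℂ} (hv : fr.IsRegular v) : fr.q / v ≠ v := by
  intro h
  rw [div_eq_iff hv.ne_zero] at h
  exact hv.sq_ne (by rw [h, pow_two])

/-- The tangent direction times q/v - v, divided by v, is -|v² - q|². -/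
lemma IsRegular.isogonalAt_self (hF : F.IsHomogeneous 3) {v : ℂ} (hv : fr.IsRegular v) :
    fr.IsogonalAt v (fr.pt v) (fr.pt (fr.q / v)) := by
  refine ⟨_, _, hv.tangent_ne, sub_ne_zero.2 hv.conj_ne, hv.lineXY_self hF, lineXY_pt hv.conj_ne, ?_⟩
  have h := hv.ne_zero
  have : v ^ 2 * conj (v ^ 2 - fr.q) * (fr.q / v - v) / v =
      ((-Complex.normSq (v ^ 2 - fr.q) : ℝ) : ℂ) := by
    push_cast
    rw [← Complex.mul_conj]
    field_simp
    ring
  rw [this, Complex.ofReal_im]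

lemma IsogonalAt.symm {v : ℂ} {X Z : RP2} (h : fr.IsogonalAt v X Z) : fr.IsogonalAt v Z X := by
  obtain ⟨d, d', hd, hd', h1, h2, h⟩ := h
  exact ⟨d', d, hd', hd, h2, h1, by rwa [mul_comm]⟩

lemma IsRegular.isogonalAt_of_conj (hF : F.IsHomogeneous 3) {v : ℂ} (hv : fr.IsRegular v)
    {X W : RP2} (h : fr.Conj X W) : fr.IsogonalAt v X W := by
  have hv0 := hv.ne_zero
  have hcenter : fr.IsogonalAt v (fr.pt 0) fr.inf := by
    refine ⟨0 - v, 1, by simpa using hv0, one_ne_zero, lineXY_pt hv0.symm, lineXY_inf v, ?_⟩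
    rw [zero_sub, mul_one, neg_div, div_self hv0]
    simp
  rcases h with ⟨η, hη0, hη, rfl, rfl⟩ | ⟨rfl, rfl⟩ | ⟨rfl, rfl⟩
  · by_cases h1 : η = v
    · subst h1
      exact hv.isogonalAt_self hF
    by_cases h2 : fr.q / η = v
    · have : η = fr.q / v := by
        rw [← h2]
        have := fr.q_ne_zero
        field_simp
      rw [h2, this]
      exact (hv.isogonalAt_self hF).symm
    refine ⟨_, _, sub_ne_zero.2 h1, sub_ne_zero.2 h2, lineXY_pt h1, lineXY_pt h2, ?_⟩
    -- Both brackets on the right have imaginary part k, since v and η lie on the curve.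
    have e : (η - v) * (fr.q / η - v) / v = (v + fr.q / v) - (η + fr.q / η) := by
      field_simp
      ring
    have e1 := hv.mem
    rw [frameForm_one _ _ hv0] at e1
    rw [frameForm_one _ _ hη0] at hη
    have n1 : Complex.normSq v ≠ 0 := by simpa using hv0
    have n2 : Complex.normSq η ≠ 0 := by simpa using hη0
    rw [e, Complex.sub_im]
    linarith [(mul_eq_zero.1 e1).resolve_left n1, (mul_eq_zero.1 hη).resolve_left n2]
  · exact hcenter
  · exact hcenter.symm

lemma IsRegular.lineXY_eq {v : ℂ} (hv : fr.IsRegular v) {X Z W : RP2}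
    (hZ : fr.IsogonalAt v X Z) (hW : fr.IsogonalAt v X W) :
    lineXY F (fr.pt v) Z = lineXY F (fr.pt v) W := by
  have hv0 := hv.ne_zero
  obtain ⟨a, b, ha, hb, h1, h2, h3⟩ := hZ
  obtain ⟨a', b', ha', hb', h1', h2', h3'⟩ := hW
  rw [h2, h2', line_eq_iff v hb hb']
  rw [h1, line_eq_iff v ha ha'] at h1'
  obtain ⟨r, hr⟩ := im_eq_zero_iff.1 h3
  obtain ⟨s, hs⟩ := im_eq_zero_iff.1 (im_div_comm_eq_zero h3')
  obtain ⟨t, ht⟩ := im_eq_zero_iff.1 (im_div_comm_eq_zero h1')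
  refine im_eq_zero_iff.2 ⟨r * s * t, ?_⟩
  push_cast
  rw [← hr, ← hs, ← ht]
  field_simp

variable (fr) in
-- On a common line α + γ = β + ε + 1 forces the direction to be real, so all heights agree. The
-- imaginary part of αγ = βε then makes this height 0, whence k = 0 and q is real.
lemma not_collinear {l : ProjLine} (hl : Module.finrank ℝ l = 2) (hA : OnLine (fr.pt fr.α) l)
    (hB : OnLine (fr.pt fr.β) l) (hC : OnLine (fr.pt fr.γ) l) (hD : OnLine (fr.pt fr.ε) l) :
    False := by
  have hne : fr.β - fr.α ≠ 0 := by
    intro h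
    rw [sub_eq_zero] at h
    exact Q.ne_AB (by rw [fr.hA, fr.hB, h])
  have hne' : fr.pt fr.α ≠ fr.pt fr.β := fun h => sub_ne_zero.1 hne (fr.pt_injective h).symm
  have h := fr.δ_ne
  rw [← joinLine_eq_of_onLine hne' hl hA hB, joinLine_pt, line, pt,
    onLine_affinePt_dirLine _ _ (mul_ne_zero h hne), add_sub_add_left_eq_sub, ← mul_sub,
    mul_div_mul_left _ _ h] at hC hD
  obtain ⟨r, hr⟩ := im_eq_zero_iff.1 hC
  obtain ⟨s, hs⟩ := im_eq_zero_iff.1 hD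
  rw [div_eq_iff hne] at hr hs
  have h1 : ((r - s - 1 : ℝ) : ℂ) * (fr.β - fr.α) = 1 := by
    push_cast
    linear_combination (-1 : ℂ) * hr + hs + fr.sum_eq
  have h2 := congrArg Complex.im h1
  rw [Complex.im_ofReal_mul, Complex.one_im, mul_eq_zero, Complex.sub_im] at h2
  have h3 : fr.β.im - fr.α.im = 0 := by
    refine h2.resolve_left fun h0 => ?_
    rw [h0] at h1
    simp at h1
  have h4 := congrArg Complex.im hr
  have h5 := congrArg Complex.im hs
  rw [Complex.im_ofReal_mul, Complex.sub_im, Complex.sub_im, h3, mul_zero] at h4 h5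
  have h6 := congrArg Complex.im (fr.αγ.trans fr.βε.symm)
  have h7 := congrArg Complex.re fr.sum_eq
  have h8 := congrArg Complex.im fr.αγ
  have h9 := fr.hk
  simp only [Complex.mul_im, Complex.add_re, Complex.one_re, Complex.add_im] at h6 h7 h8 h9
  have b1 : fr.β.im = fr.α.im := by linarith
  have b2 : fr.γ.im = fr.α.im := by linarith
  have b3 : fr.ε.im = fr.α.im := by linarith
  rw [b1, b2, b3] at h6
  rw [b2] at h8 h9
  have h0 : fr.α.im = 0 := by linear_combination h6 - fr.α.im * h7
  apply fr.nondeg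
  rw [h0] at h8 h9
  exact ⟨by linarith, by rw [← h8]; ring⟩

variable (fr) in
theorem isogonalConjugates_iff_eq (hF : F.IsHomogeneous 3) {X W : RP2} (h : fr.Conj X W)
    (Z : RP2) : Q.IsogonalConjugates F X Z ↔ Z = W := by
  rw [fr.isogonalConjugates_iff hF]
  have hα := fr.isRegular_α
  have hβ := fr.isRegular_β
  have hγ := fr.isRegular_γ
  have hε := fr.isRegular_ε
  have kα := hα.isogonalAt_of_conj hF h
  have kβ := hβ.isogonalAt_of_conj hF h
  have kγ := hγ.isogonalAt_of_conj hF h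
  have kε := hε.isogonalAt_of_conj hF h
  constructor
  · rintro ⟨h1, h2, h3, h4⟩
    by_contra hne
    exact fr.not_collinear (finrank_joinLine hne)
      (onLine_of_lineXY_eq hne (hα.lineXY_eq h1 kα)) (onLine_of_lineXY_eq hne (hβ.lineXY_eq h2 kβ))
      (onLine_of_lineXY_eq hne (hγ.lineXY_eq h3 kγ)) (onLine_of_lineXY_eq hne (hε.lineXY_eq h4 kε))
  · rintro rfl
    exact ⟨kα, kβ, kγ, kε⟩

variable (fr) in
-- Eliminating the ratio gives (D - S)(B - S) = (C - S)(A - S), where S² cancels and the coefficient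
-- of S is ±δ. Conversely ε/α = γ/β because αγ = βε.
lemma isSpiralCenter_iff (S : ℂ) : Q.IsSpiralCenter S ↔ S = fr.P := by
  have hq := fr.q_ne_zero
  have h1 := fr.αγ
  have h2 := fr.βε
  have hδ := fr.δ_ne
  have hα : fr.α ≠ 0 := fr.isRegular_α.ne_zero
  have hε : fr.ε ≠ 0 := fr.isRegular_ε.ne_zero
  constructor
  · rintro ⟨t, -, hD, hC⟩
    have h : (Q.D - S) * (Q.B - S) = (Q.C - S) * (Q.A - S) := by rw [hD, hC]; ring
    rw [fr.hA, fr.hB, fr.hC, fr.hD] at h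
    have : fr.δ * (S - fr.P) = 0 := by
      linear_combination h + fr.δ ^ 2 * (h1 - h2) - fr.δ * (S - fr.P) * fr.sum_eq
    exact sub_eq_zero.1 ((mul_eq_zero.1 this).resolve_left hδ)
  · rintro rfl
    refine ⟨fr.ε / fr.α, div_ne_zero hε hα, ?_, ?_⟩
    · rw [fr.hA, fr.hD]; field_simp; ring
    · rw [fr.hB, fr.hC]; field_simp; linear_combination fr.δ * (h1 - h2)

/-- The common point at infinity makes the change of frame η ↦ s(η + wD) with s real. In a normal
form the terms quadratic in η are a multiple of |η|², whereas the shift by D adds 2 Re(D η̄) Im η +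
|η|² Im D up to scale, which is isotropic only for D = 0. -/
theorem center_eq {Q' : Quadrilateral} (fr : IsogonalFrame F Q) (fr' : IsogonalFrame F Q') :
    fr'.P = fr.P := by
  have hδ := fr.δ_ne
  have hδ' := fr'.δ_ne
  have hc := fr.c_ne
  have hc' := fr'.c_ne
  have key : ∀ (η : ℂ) (w : ℝ), fr.c * frameForm fr.q fr.k η w =
      fr'.c * frameForm fr'.q fr'.k ((w * (fr.P - fr'.P) + fr.δ * η) / fr'.δ) w := by
    intro η w
    rw [← fr.eval_eq, ← fr'.eval_eq]
    congr 3
    field_simp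
    ring
  have h0 := key 1 0
  have him : (fr.δ / fr'.δ).im = 0 := by
    simpa [frameForm, hc', hδ, hδ'] using h0.symm
  obtain ⟨s, hs⟩ := im_eq_zero_iff.1 him
  have hs0 : s ≠ 0 := by
    rintro rfl
    exact div_ne_zero hδ hδ' (by simpa using hs)
  obtain ⟨D, hD⟩ : ∃ D, D = (fr.P - fr'.P) / fr.δ := ⟨_, rfl⟩
  have key' : ∀ (η : ℂ) (w : ℝ), fr.c * frameForm fr.q fr.k η w =
      fr'.c * frameForm fr'.q fr'.k (s * (w * D + η)) w := by
    intro η w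
    rw [key]
    congr 2
    rw [← hs, hD]
    field_simp
  -- Differences between w = 1 and w = -1 isolate the terms odd in w; the four values of η separate
  -- the quadratic coefficients from the constant.
  have z1 := key' 0 1
  have z2 := key' 0 (-1)
  have a1 := key' 1 1
  have a2 := key' 1 (-1)
  have b1 := key' Complex.I 1
  have b2 := key' Complex.I (-1)
  have d1 := key' (1 + Complex.I) 1
  have d2 := key' (1 + Complex.I) (-1)
  simp [frameForm, Complex.normSq_apply, -mul_eq_zero, -zero_eq_mul] at z1 z2 a1 a2 b1 b2 d1 d2
  have hDi : fr'.c * s ^ 3 * D.im = 0 := by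
    linear_combination (1 / 4) * ((a1 - a2) - (b1 - b2))
  have hDr : fr'.c * s ^ 3 * D.re = 0 := by
    linear_combination (-1 / 4) * ((d1 - d2) - 2 * (a1 - a2) + (z1 - z2)) - hDi
  have hne : fr'.c * s ^ 3 ≠ 0 := mul_ne_zero hc' (pow_ne_zero 3 hs0)
  have hD0 : D = 0 := Complex.ext (by simpa [hne] using hDr) (by simpa [hne] using hDi)
  rw [hD0] at hD
  have := (div_eq_zero_iff.1 hD.symm).resolve_right hδ
  exact (sub_eq_zero.1 this).symm

end IsogonalFrame

end Conjugates

end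

theorem mainTheorem5 (F : MvPolynomial (Fin 3) ℝ) (hF : IsNondegenerateCubic F)
    (hC : ∃ Q : Quadrilateral, Q.HasIsogonalCubic F) :
    ∃ (P : ℂ) (Pinf : RP2),
      -- `P` is the spiral center of the curve, whichever base quadrilateral is used
      affinePt P ∈ curve F ∧
      (∀ Q : Quadrilateral, Q.HasIsogonalCubic F → ∀ S : ℂ, Q.IsSpiralCenter S ↔ S = P) ∧
      -- `Pinf` is the point at infinity of the curve
      (∀ Z : RP2, (Z ∈ curve F ∧ AtInfinity Z) ↔ Z = Pinf) ∧
      ∀ X ∈ curve F, ∃ Y ∈ curve F, ∃ W ∈ curve F,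
        -- `Y = PX ∩ 𝒞` and `W = P∞Y ∩ 𝒞`
        (∀ Z : RP2, IsThirdIntersection F (affinePt P) X Z ↔ Z = Y) ∧
        (∀ Z : RP2, IsThirdIntersection F Pinf Y Z ↔ Z = W) ∧
        -- `W` is the one and only isogonal conjugate of `X`, in every base quadrilateral
        ∀ Q : Quadrilateral, Q.HasIsogonalCubic F →
          ∀ Z : RP2, Q.IsogonalConjugates F X Z ↔ Z = W := by
  obtain ⟨Q₀, hQ₀⟩ := hC
  obtain ⟨fr₀⟩ := nonempty_isogonalFrame hF hQ₀
  have hhom := hF.1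
  refine ⟨fr₀.P, fr₀.inf, ?_, fun Q hQ S => ?_, fr₀.mem_curve_atInfinity_iff hhom, fun X hX => ?_⟩
  · rw [← fr₀.pt_zero, fr₀.pt_mem_curve_iff hhom, frameForm_zero_left]
  · obtain ⟨fr⟩ := nonempty_isogonalFrame hF hQ
    rw [fr.isSpiralCenter_iff, fr₀.center_eq fr]
  · obtain ⟨Y, hY, W, hW, h1, h2, -⟩ := fr₀.exists_thirdIntersections hhom hX
    rw [fr₀.pt_zero] at h1
    refine ⟨Y, hY, W, hW, h1, h2, fun Q hQ => ?_⟩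
    obtain ⟨fr⟩ := nonempty_isogonalFrame hF hQ
    obtain ⟨Y', -, W', -, h1', h2', h3'⟩ := fr.exists_thirdIntersections hhom hX
    -- The conjugate in an arbitrary frame is identified with `W` because both are the same third
    -- intersections.
    rw [fr.pt_zero, fr₀.center_eq fr] at h1'
    have hinf : fr.inf = fr₀.inf := (fr₀.mem_curve_atInfinity_iff hhom _).1
      ((fr.mem_curve_atInfinity_iff hhom _).2 rfl)
    have hYY : Y' = Y := (h1 Y').1 ((h1' Y').2 rfl)
    rw [hinf, hYY] at h2'
    have hWW : W' = W := (h2 W').1 ((h2' W').2 rfl)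
    exact hWW ▸ fr.isogonalConjugates_iff_eq hhom h3'
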